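/- Let $n\ge 0$, and let $D^\alpha=D_1^{\alpha_1}\cdots D_n^{\alpha_n}$ with $D_j=-i\,\partial/\partial x_j$. Let $Q\neq 0$ be a polynomial in $n$ variables with complex coefficients, $Q(\xi)=\sum_\alpha a_\alpha\xi^\alpha$, of degree $m$; the differential operator $Q(D)=\sum_\alpha a_\alpha D^\alpha$ is also denoted by $Q$, and $Q^{(\beta)}=\partial_\xi^\beta Q$. For real $d$, the operator $Q$ is called $d$-hypoelliptic if $d$ is the smallest real number $\ge 1$ for which there is $C>0$ such that $$|\xi|^{|\beta|/d}\,|Q^{(\beta)}(\xi)|\le C\,(1+|Q(\xi)|)\qquad\text{for all }\beta\in\mathbb{Z}_+^n,\ \xi\in\mathbb{R}^n .$$ Let $\mu,\nu\ge 1$ be integers, let $d=\mu/\nu$ and $\gamma=dm\mu$, and assume that $Q$ is $d$-hypoelliptic. Let $\omega\subset\mathbb{R}^n$ be a bounded open set and, for $\delta>0$, put $\omega_\delta=\{x\in\omega:\ \operatorname{dist}(x,\mathbb{R}^n\setminus\omega)>\delta\}$, where the distance to the empty set is $+\infty$. Then there is a constant $C>0$ such that for all integers $k\ge 0$, all $\alpha\in\mathbb{Z}_+^n$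 with $|\alpha|\le km\nu$, all $\delta>0$ and all complex-valued $u\in C^\infty(\omega)$, $$\|D^\alpha u\|_{L^2(\omega_\delta)}\le C^k\sum_{i=0}^k\binom{k}{i}\Big(\frac{k}{\delta}\Big)^{(k-i)\gamma}\,\|Q^{\mu i}u\|_{L^2(\omega)} .$$ Here $L^2$ norms take values in $[0,+\infty]$, and $(k/\delta)^{0}=1$ also when $k=0$. -/

import Mathlib

open scoped ENNReal

noncomputable section

namespace IteratedInterior

/-- `D_j u = -i ∂u/∂x_j`, for complex-valued functions on `ℝⁿ`. -/
def partialD {n : ℕ} (j : Fin n) (u : EuclideanSpace ℝ (Fin n) → ℂ) :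
    EuclideanSpace ℝ (Fin n) → ℂ :=
  fun x => -Complex.I * fderiv ℝ u x (EuclideanSpace.single j (1 : ℝ))

/-- `D^α = D_0^{α_0} ⋯ D_{n-1}^{α_{n-1}}`. -/
def multiD {n : ℕ} (α : Fin n →₀ ℕ) (u : EuclideanSpace ℝ (Fin n) → ℂ) :
    EuclideanSpace ℝ (Fin n) → ℂ :=
  (List.finRange n).foldr (fun j v => (partialD j)^[α j] v) u

/-- The constant coefficient operator `Q(D) = ∑_α a_α D^α` with symbol `Q(ξ) = ∑_α a_α ξ^α`. -/
def diffOp {n : ℕ} (Q : MvPolynomial (Fin n) ℂ) (u : EuclideanSpace ℝ (Fin n) → ℂ) :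
    EuclideanSpace ℝ (Fin n) → ℂ :=
  fun x => ∑ α ∈ Q.support, Q.coeff α * multiD α u x

/-- `Q^{(β)} = ∂_ξ^β Q`. -/
def symbolDeriv {n : ℕ} (β : Fin n →₀ ℕ) (Q : MvPolynomial (Fin n) ℂ) :
    MvPolynomial (Fin n) ℂ :=
  (List.finRange n).foldr (fun j P => (MvPolynomial.pderiv j)^[β j] P) Q

/-- The value `Q(ξ)` at a real point `ξ`. -/
def symbolAt {n : ℕ} (Q : MvPolynomial (Fin n) ℂ) (ξ : EuclideanSpace ℝ (Fin n)) : ℂ :=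
  MvPolynomial.eval (fun j => (ξ j : ℂ)) Q

/-- `∃ C > 0, ∀ β ξ, |ξ|^{|β|/d} |Q^{(β)}(ξ)| ≤ C (1 + |Q(ξ)|)`. -/
def SymbolEstimate {n : ℕ} (Q : MvPolynomial (Fin n) ℂ) (d : ℝ) : Prop :=
  ∃ C : ℝ, 0 < C ∧ ∀ (β : Fin n →₀ ℕ) (ξ : EuclideanSpace ℝ (Fin n)),
    ‖ξ‖ ^ ((β.degree : ℝ) / d) * ‖symbolAt (symbolDeriv β Q) ξ‖ ≤ C * (1 + ‖symbolAt Q ξ‖)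

/-- `Q(D)` is `d`-hypoelliptic: `Q` is not the zero operator and `d` is the smallest real number
`≥ 1` for which the symbol estimate holds. -/
def IsDHypoelliptic {n : ℕ} (Q : MvPolynomial (Fin n) ℂ) (d : ℝ) : Prop :=
  Q ≠ 0 ∧ IsLeast {s : ℝ | 1 ≤ s ∧ SymbolEstimate Q s} d

/-- `ω_δ = {x ∈ ω : dist(x, ∁ω) > δ}`; the distance to the empty set is `∞`. -/
def shrink {n : ℕ} (ω : Set (EuclideanSpace ℝ (Fin n))) (δ : ℝ) :
    Set (EuclideanSpace ℝ (Fin n)) :=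
  {x | x ∈ ω ∧ ENNReal.ofReal δ < Metric.infEDist x ωᶜ}

/-- The `L²(A)` norm, with values in `[0, ∞]`. -/
def l2Norm {n : ℕ} (A : Set (EuclideanSpace ℝ (Fin n)))
    (f : EuclideanSpace ℝ (Fin n) → ℂ) : ℝ≥0∞ :=
  MeasureTheory.eLpNorm f 2 (MeasureTheory.volume.restrict A)

end IteratedInterior

end

noncomputable section

namespace IteratedInterior

open MvPolynomial MeasureTheory
open scoped SchwartzMap LineDeriv FourierTransform Convolution

variable {n : ℕ}

/-! Put `P = Q^μ`, of degree at most `N = mμ`, let `P_β` be its Taylor coefficients, and let `γ =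
dN`. Everything follows from one interior estimate for `P`, applied `k` times with step `h =
δ/(2k)`: for `|α| ≤ mν`, the norm of `D^α v` on a set shrunk by a further `h` is at most `C (‖P v‖ +
h^{-γ} ‖v‖)` on the larger set, with `C` independent of `h` and of the two sets.

The symbol estimate passes from `Q` to `P`, because Taylor coefficients of a product are
convolutions. At a multi-index of top degree it reads `|ξ|^{m/d} ≤ C (1 + |Q(ξ)|)`, whose `μ`-th
power is `|ξ|^{mν} ≤ C (1 + |P(ξ)|)` up to constants (`SymbolEstimate.exists_pow_le`). By
Plancherel, `P` therefore controls `D^α` on the whole space. To localise, take a cutoff `φ` at scale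
`h`; by Leibniz, `P(D)(φ v)` differs from `φ P(D) v` by terms bounded by `h^{-|β|} ‖P_β(D) v‖`, `β ≠
0`, which are collected in `lowerSum`.

Splitting frequencies at `|ζ|^{1/d} ~ 1/h` gives `h^{-|β|} |P_β| ≤ κ |P| + C h^{-γ}` for any `κ > 0`
(`exists_interpolation_le`). Estimating `lowerSum` in this way reproduces it on a larger set with a
small factor. It is absorbed by halving `h` repeatedly (`exists_lowerSum_le`), which yields
`exists_interior_estimate`. In the iteration `P` commutes with derivatives and Pascal's rule
produces the binomial coefficients (`nrm_op_monomial_le_of_step`). -/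

/-! ### Taylor coefficients of polynomials -/

/-- The Taylor expansion `P(X + Y)`, as a polynomial in `Y` with coefficients in `ℂ[X]`. -/
def taylor : MvPolynomial (Fin n) ℂ →ₐ[ℂ] MvPolynomial (Fin n) (MvPolynomial (Fin n) ℂ) :=
  aeval fun j => C (X j) + X j

@[simp] lemma taylor_X (j : Fin n) : taylor (X j) = C (X j) + X j := by simp [taylor]

@[simp] lemma taylor_C (c : ℂ) : taylor (C c : MvPolynomial (Fin n) ℂ) = C (C c) := by
  simp [taylor, algebraMap_eq, IsScalarTower.algebraMap_apply ℂ (MvPolynomial (Fin n) ℂ)]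

/-- Total degree at most `N` in both sets of variables together. -/
def BidegreeLE (N : ℕ) (S : MvPolynomial (Fin n) (MvPolynomial (Fin n) ℂ)) : Prop :=
  ∀ β κ : Fin n →₀ ℕ, N < κ.degree + β.degree → coeff κ (coeff β S) = 0

lemma BidegreeLE.add {N : ℕ} {S S' : MvPolynomial (Fin n) (MvPolynomial (Fin n) ℂ)}
    (h : BidegreeLE N S) (h' : BidegreeLE N S') : BidegreeLE N (S + S') := fun β κ hβ => by
  simp [h β κ hβ, h' β κ hβ]

lemma BidegreeLE.mono {N M : ℕ} (hNM : N ≤ M)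
    {S : MvPolynomial (Fin n) (MvPolynomial (Fin n) ℂ)}
    (h : BidegreeLE N S) : BidegreeLE M S := fun β κ hβ => h β κ (by omega)

lemma BidegreeLE.mul {N M : ℕ} {S S' : MvPolynomial (Fin n) (MvPolynomial (Fin n) ℂ)}
    (h : BidegreeLE N S) (h' : BidegreeLE M S') : BidegreeLE (N + M) (S * S') := fun β κ hβ => by
  classical
  rw [coeff_mul, coeff_sum]
  refine Finset.sum_eq_zero fun b hb => ?_
  rw [coeff_mul]
  refine Finset.sum_eq_zero fun k hk => ?_
  rw [Finset.HasAntidiagonal.mem_antidiagonal] at hb hk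
  subst hb hk
  rw [map_add, map_add] at hβ
  by_cases h1 : N < k.1.degree + b.1.degree
  · simp [h _ _ h1]
  · simp [h' b.2 k.2 (by omega)]

lemma bidegreeLE_C (c : ℂ) : BidegreeLE (n := n) 0 (C (C c)) := fun β κ h => by
  classical
  rw [coeff_C]
  split_ifs with h1
  · rw [coeff_C]
    split_ifs with h2
    · subst h1 h2; simp at h
    · rfl
  · simp

lemma bidegreeLE_linear (j : Fin n) : BidegreeLE 1 (C (X j) + X j) := by
  classical
  refine BidegreeLE.add (fun β κ h => ?_) (fun β κ h => ?_)
  · rw [coeff_C]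
    split_ifs with h1
    · rw [coeff_X, if_neg]
      rintro rfl
      subst h1
      simp at h
    · simp
  · rw [coeff_X]
    split_ifs with h1
    · subst h1
      rw [coeff_one, if_neg]
      rintro rfl
      simp at h
    · simp

lemma bidegreeLE_taylor_monomial (α : Fin n →₀ ℕ) (c : ℂ) :
    BidegreeLE α.degree (taylor (monomial α c)) := by
  induction α using Finsupp.induction_linear generalizing c with
  | zero => simpa using bidegreeLE_C c
  | add f g hf hg =>
    have : monomial (f + g) c = monomial f c * monomial g 1 := by simp [monomial_mul]
    rw [this, map_mul, map_add]
    exact (hf c).mul (hg 1)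
  | single j k =>
    have : monomial (Finsupp.single j k) c = C c * X j ^ k := by
      rw [C_mul_X_pow_eq_monomial]
    rw [this, map_mul, map_pow, taylor_C, taylor_X, Finsupp.degree_single]
    have h : ∀ k : ℕ, BidegreeLE k ((C (X j) + X j : MvPolynomial (Fin n) _) ^ k) := by
      intro k
      induction k with
      | zero => simpa using bidegreeLE_C (n := n) 1
      | succ k ih => rw [pow_succ]; exact ih.mul (bidegreeLE_linear j)
    simpa using (bidegreeLE_C c).mul (h k)

/-- Used in two ways: the coefficient of `Y^β` vanishes when `|β| > N`, and otherwise it has degree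
at most `N - |β|` in `X`. -/
lemma bidegreeLE_taylor {P : MvPolynomial (Fin n) ℂ} {N : ℕ} (h : P.totalDegree ≤ N) :
    BidegreeLE N (taylor P) := by
  rw [P.as_sum, map_sum]
  refine Finset.sum_induction _ (BidegreeLE N) (fun _ _ => BidegreeLE.add)
    (fun β κ _ => by simp) fun α hα => (bidegreeLE_taylor_monomial α _).mono ?_
  refine le_trans ?_ h
  simpa [Finsupp.degree_apply, Finsupp.sum] using le_totalDegree hα

lemma coeff_taylor_eq_zero {P : MvPolynomial (Fin n) ℂ} {N : ℕ} (h : P.totalDegree ≤ N)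
    {β : Fin n →₀ ℕ} (hβ : N < β.degree) : coeff β (taylor P) = 0 := by
  ext κ
  simpa using bidegreeLE_taylor h β κ (by omega)

lemma coeff_zero_coeff_taylor (P : MvPolynomial (Fin n) ℂ) (β : Fin n →₀ ℕ) :
    coeff 0 (coeff β (taylor P)) = coeff β P := by
  have h : MvPolynomial.map constantCoeff (taylor P) = P := by
    induction P using MvPolynomial.induction_on with
    | C c => simp
    | add p q hp hq => simp [hp, hq]
    | mul_X p j hp => simp [hp]
  conv_rhs => rw [← h]
  rw [coeff_map]; rfl

lemma coeff_taylor_zero (P : MvPolynomial (Fin n) ℂ) : coeff 0 (taylor P) = P := by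
  have h : constantCoeff (taylor P) = P := by
    induction P using MvPolynomial.induction_on with
    | C c => simp
    | add p q hp hq => simp [hp, hq]
    | mul_X p j hp => simp [hp]
  exact h

/-- Taylor coefficients of top order are constants. -/
lemma coeff_taylor_top {P : MvPolynomial (Fin n) ℂ} {β : Fin n →₀ ℕ}
    (hβ : P.totalDegree = β.degree) : coeff β (taylor P) = C (coeff β P) := by
  classical
  ext κ
  rw [coeff_C]
  split_ifs with h
  · rw [← h, coeff_zero_coeff_taylor]
  · refine bidegreeLE_taylor hβ.le β κ ?_
    have : κ.degree ≠ 0 := by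
      rw [Ne, Finsupp.degree_eq_zero_iff]; exact Ne.symm h
    omega

/-- Chain rule: since the expansion depends on `X + Y` only, differentiating `P` before translation
amounts to differentiating in `Y`. -/
lemma taylor_pderiv (j : Fin n) (P : MvPolynomial (Fin n) ℂ) :
    taylor (pderiv j P) = pderiv j (taylor P) := by
  classical
  induction P using MvPolynomial.induction_on with
  | C c => simp
  | add p q hp hq => simp [hp, hq]
  | mul_X p i hp =>
    rw [Derivation.leibniz, map_mul taylor, Derivation.leibniz]
    simp only [smul_eq_mul, map_add, map_mul, taylor_X, hp, pderiv_X, pderiv_C, zero_add]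
    rcases eq_or_ne i j with rfl | hij <;> simp_all

lemma taylor_pderiv_iterate (j : Fin n) (k : ℕ) (P : MvPolynomial (Fin n) ℂ) :
    taylor ((pderiv j)^[k] P) = (pderiv j)^[k] (taylor P) := by
  induction k generalizing P with
  | zero => rfl
  | succ k ih => simp only [Function.iterate_succ_apply, ih, taylor_pderiv]

lemma coeff_pderiv_iterate (j : Fin n) (k : ℕ)
    (S : MvPolynomial (Fin n) (MvPolynomial (Fin n) ℂ)) (θ : Fin n →₀ ℕ) :
    ∃ N : ℕ, 1 ≤ N ∧ coeff θ ((pderiv j)^[k] S) = N * coeff (θ + Finsupp.single j k) S := by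
  induction k generalizing θ with
  | zero => exact ⟨1, le_rfl, by simp⟩
  | succ k ih =>
    obtain ⟨N, hN, h⟩ := ih (θ + Finsupp.single j 1)
    refine ⟨N * (θ j + 1), Nat.mul_pos hN (Nat.succ_pos _), ?_⟩
    rw [Function.iterate_succ_apply', coeff_pderiv, h, add_assoc, ← Finsupp.single_add,
      add_comm 1 k]
    push_cast
    ring

lemma exists_coeff_taylor_foldr (P : MvPolynomial (Fin n) ℂ) (β : Fin n →₀ ℕ) (l : List (Fin n))
    (θ : Fin n →₀ ℕ) :
    ∃ N : ℕ, 1 ≤ N ∧ coeff θ (taylor (l.foldr (fun j R => (pderiv j)^[β j] R) P)) =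
      N * coeff (θ + (l.map fun j => Finsupp.single j (β j)).sum) (taylor P) := by
  induction l generalizing θ with
  | nil => exact ⟨1, le_rfl, by simp⟩
  | cons j l ih =>
    rw [List.foldr_cons, taylor_pderiv_iterate]
    obtain ⟨N, hN, h⟩ := coeff_pderiv_iterate j (β j)
      (taylor (l.foldr (fun j R => (pderiv j)^[β j] R) P)) θ
    obtain ⟨M, hM, h'⟩ := ih (θ + Finsupp.single j (β j))
    refine ⟨N * M, Nat.mul_pos hN hM, ?_⟩
    rw [h, h', List.map_cons, List.sum_cons, add_assoc]
    push_cast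
    ring

/-- The integer is `β!`; only the bound `N ≥ 1` matters, since it lets estimates on derivatives pass
to Taylor coefficients. -/
lemma exists_symbolDeriv_eq (β : Fin n →₀ ℕ) (P : MvPolynomial (Fin n) ℂ) :
    ∃ N : ℕ, 1 ≤ N ∧ symbolDeriv β P = N * coeff β (taylor P) := by
  obtain ⟨N, hN, h⟩ := exists_coeff_taylor_foldr P β (List.finRange n) 0
  refine ⟨N, hN, ?_⟩
  rw [coeff_taylor_zero, zero_add] at h
  rw [symbolDeriv, h]
  congr 2
  rw [← List.ofFn_eq_map, List.sum_ofFn]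
  exact Finsupp.univ_sum_single β

lemma norm_coeff_taylor_le (β : Fin n →₀ ℕ) (P : MvPolynomial (Fin n) ℂ)
    (ξ : EuclideanSpace ℝ (Fin n)) :
    ‖symbolAt (coeff β (taylor P)) ξ‖ ≤ ‖symbolAt (symbolDeriv β P) ξ‖ := by
  obtain ⟨N, hN, h⟩ := exists_symbolDeriv_eq β P
  rw [h]
  simp only [symbolAt, map_mul, map_natCast, norm_mul, Complex.norm_natCast]
  exact le_mul_of_one_le_left (norm_nonneg _) (by exact_mod_cast hN)

/-! ### Symbol estimates and interpolation -/

lemma symbolAt_mul (P R : MvPolynomial (Fin n) ℂ) (ζ : EuclideanSpace ℝ (Fin n)) :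
    symbolAt (P * R) ζ = symbolAt P ζ * symbolAt R ζ := map_mul _ _ _

lemma symbolAt_add (P R : MvPolynomial (Fin n) ℂ) (ζ : EuclideanSpace ℝ (Fin n)) :
    symbolAt (P + R) ζ = symbolAt P ζ + symbolAt R ζ := map_add _ _ _

lemma symbolAt_pow (P : MvPolynomial (Fin n) ℂ) (k : ℕ) (ζ : EuclideanSpace ℝ (Fin n)) :
    symbolAt (P ^ k) ζ = symbolAt P ζ ^ k := map_pow _ _ _

lemma one_add_pow_le {x : ℝ} (hx : 0 ≤ x) (k : ℕ) : (1 + x) ^ k ≤ 2 ^ k * (1 + x ^ k) := by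
  have h := add_pow_le zero_le_one hx k
  rw [one_pow] at h
  refine h.trans ?_
  gcongr
  · norm_num
  · omega

lemma norm_symbolAt_monomial_le (α : Fin n →₀ ℕ) (ζ : EuclideanSpace ℝ (Fin n)) :
    ‖symbolAt (monomial α 1) ζ‖ ≤ (1 + ‖ζ‖) ^ α.degree := by
  rw [symbolAt, eval_monomial, one_mul, Finsupp.prod, norm_prod, Finsupp.degree_apply,
    ← Finset.prod_pow_eq_pow_sum]
  refine Finset.prod_le_prod (fun _ _ => norm_nonneg _) fun j _ => ?_
  rw [norm_pow, Complex.norm_real]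
  exact pow_le_pow_left₀ (norm_nonneg _)
    ((PiLp.norm_apply_le ζ j).trans (by linarith [norm_nonneg ζ])) _

lemma exists_norm_symbolAt_le (S : MvPolynomial (Fin n) ℂ) {N : ℕ}
    (hS : ∀ κ ∈ S.support, κ.degree ≤ N) :
    ∃ C : ℝ, 0 < C ∧ ∀ ζ, ‖symbolAt S ζ‖ ≤ C * (1 + ‖ζ‖) ^ N := by
  refine ⟨(∑ κ ∈ S.support, ‖coeff κ S‖) + 1, by positivity, fun ζ => ?_⟩
  have h1 : (1 : ℝ) ≤ 1 + ‖ζ‖ := by linarith [norm_nonneg ζ]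
  have h : symbolAt S ζ = ∑ κ ∈ S.support, coeff κ S * symbolAt (monomial κ 1) ζ := by
    simp [symbolAt, eval_eq']
  rw [h, add_mul, Finset.sum_mul]
  refine (norm_sum_le _ _).trans (le_add_of_le_of_nonneg (Finset.sum_le_sum fun κ hκ => ?_)
    (by positivity))
  rw [norm_mul]
  gcongr
  exact (norm_symbolAt_monomial_le κ ζ).trans (pow_le_pow_right₀ h1 (hS κ hκ))

/-- Taylor coefficients of powers of a polynomial satisfying the symbol estimate. -/
lemma SymbolEstimate.exists_norm_coeff_taylor_pow_le {Q : MvPolynomial (Fin n) ℂ} {d : ℝ}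
    (hd : 0 < d) (hQ : SymbolEstimate Q d) (k : ℕ) (β : Fin n →₀ ℕ) :
    ∃ C : ℝ, 0 < C ∧ ∀ ζ, ‖ζ‖ ^ ((β.degree : ℝ) / d) * ‖symbolAt (coeff β (taylor (Q ^ k))) ζ‖ ≤
      C * (1 + ‖symbolAt Q ζ‖) ^ k := by
  classical
  obtain ⟨C₀, hC₀, hQ⟩ := hQ
  induction k generalizing β with
  | zero =>
    refine ⟨1, one_pos, fun ζ => ?_⟩
    rw [pow_zero, map_one, coeff_one, pow_zero, mul_one]
    split_ifs with h
    · subst h; simp [symbolAt]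
    · simp [symbolAt]
  | succ k ih =>
    choose C hC h using ih
    refine ⟨(∑ b ∈ Finset.HasAntidiagonal.antidiagonal β, C b.1 * C₀) + 1,
      add_pos_of_nonneg_of_pos
        (Finset.sum_nonneg fun b _ => mul_nonneg (hC _).le hC₀.le) one_pos, fun ζ => ?_⟩
    rw [pow_succ, map_mul, coeff_mul, add_mul, Finset.sum_mul]
    refine le_add_of_le_of_nonneg ?_ (by positivity)
    have : symbolAt (∑ b ∈ Finset.HasAntidiagonal.antidiagonal β,
        coeff b.1 (taylor (Q ^ k)) * coeff b.2 (taylor Q)) ζ =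
        ∑ b ∈ Finset.HasAntidiagonal.antidiagonal β,
        symbolAt (coeff b.1 (taylor (Q ^ k))) ζ * symbolAt (coeff b.2 (taylor Q)) ζ := by
      simp [symbolAt]
    rw [this]
    refine (mul_le_mul_of_nonneg_left (norm_sum_le _ _) (by positivity)).trans ?_
    rw [Finset.mul_sum]
    refine Finset.sum_le_sum fun b hb => ?_
    rw [Finset.HasAntidiagonal.mem_antidiagonal] at hb
    -- The weight splits along `β = b.1 + b.2`, one factor going to each Taylor coefficient.
    rw [← hb, map_add, Nat.cast_add, add_div, Real.rpow_add_of_nonneg (norm_nonneg _)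
      (by positivity) (by positivity), norm_mul, pow_succ]
    calc _ = (‖ζ‖ ^ ((b.1.degree : ℝ) / d) * ‖symbolAt (coeff b.1 (taylor (Q ^ k))) ζ‖) *
          (‖ζ‖ ^ ((b.2.degree : ℝ) / d) * ‖symbolAt (coeff b.2 (taylor Q)) ζ‖) := by ring
      _ ≤ (C b.1 * (1 + ‖symbolAt Q ζ‖) ^ k) * (C₀ * (1 + ‖symbolAt Q ζ‖)) := by
        refine mul_le_mul (h _ ζ) (le_trans ?_ (hQ b.2 ζ)) (by positivity)
          (mul_nonneg (hC _).le (by positivity))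
        gcongr
        exact norm_coeff_taylor_le _ _ _
      _ = _ := by ring

lemma SymbolEstimate.exists_norm_coeff_taylor_pow_le' {Q : MvPolynomial (Fin n) ℂ} {d : ℝ}
    (hd : 0 < d) (hQ : SymbolEstimate Q d) (k : ℕ) (β : Fin n →₀ ℕ) :
    ∃ C : ℝ, 0 < C ∧ ∀ ζ, ‖ζ‖ ^ ((β.degree : ℝ) / d) * ‖symbolAt (coeff β (taylor (Q ^ k))) ζ‖ ≤
      C * (1 + ‖symbolAt (Q ^ k) ζ‖) := by
  obtain ⟨C, hC, h⟩ := hQ.exists_norm_coeff_taylor_pow_le hd k β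
  refine ⟨C * 2 ^ k, by positivity, fun ζ => (h ζ).trans ?_⟩
  rw [symbolAt_pow, norm_pow, mul_assoc]
  gcongr
  exact one_add_pow_le (norm_nonneg _) k

/-- Powers of a hypoelliptic symbol control powers of the frequency. -/
lemma SymbolEstimate.exists_pow_le {Q : MvPolynomial (Fin n) ℂ} {μ ν : ℕ} (hμ : 0 < μ)
    (hν : 0 < ν) (hQ0 : Q ≠ 0) (hQ : SymbolEstimate Q ((μ : ℝ) / ν)) :
    ∃ C : ℝ, 0 < C ∧ ∀ ζ, (1 + ‖ζ‖) ^ (Q.totalDegree * ν) ≤ C * (1 + ‖symbolAt (Q ^ μ) ζ‖) := by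
  have hμ' : (0 : ℝ) < μ := by exact_mod_cast hμ
  have hν' : (0 : ℝ) < ν := by exact_mod_cast hν
  obtain ⟨C, hC, hQ⟩ := hQ
  -- A monomial of top degree: its Taylor coefficient is a nonzero constant, so the symbol estimate
  -- bounds the pure power `|ζ|^{m/d}`.
  obtain ⟨β, hβ, hdeg⟩ := Finset.exists_mem_eq_sup Q.support
    (support_nonempty.2 hQ0) (fun s => s.sum fun _ e => e)
  have hdeg : Q.totalDegree = β.degree := hdeg
  have ha : 0 < ‖coeff β Q‖ := norm_pos_iff.2 (mem_support_iff.1 hβ)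
  have hb : ∀ ζ, ‖ζ‖ ^ (Q.totalDegree * ν) ≤
      (C / ‖coeff β Q‖) ^ μ * (1 + ‖symbolAt Q ζ‖) ^ μ := by
    intro ζ
    have h1 := (mul_le_mul_of_nonneg_left (norm_coeff_taylor_le β Q ζ)
      (by positivity)).trans (hQ β ζ)
    rw [coeff_taylor_top hdeg, symbolAt, eval_C, ← le_div_iff₀ ha] at h1
    have h2 := pow_le_pow_left₀ (by positivity) h1 μ
    rw [← Real.rpow_natCast, ← Real.rpow_mul (norm_nonneg _), ← hdeg] at h2
    -- Raising to the power `μ` turns the exponent `m/d` into the integer `mν`.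
    have h3 : (Q.totalDegree : ℝ) / (μ / ν) * μ = (Q.totalDegree * ν : ℕ) := by
      push_cast; field_simp
    rw [h3, Real.rpow_natCast] at h2
    refine h2.trans (le_of_eq ?_)
    rw [← mul_pow]; congr 1; ring
  refine ⟨2 ^ (Q.totalDegree * ν) * (1 + (C / ‖coeff β Q‖) ^ μ * 2 ^ μ), by positivity,
    fun ζ => (one_add_pow_le (norm_nonneg ζ) _).trans ?_⟩
  rw [mul_assoc]
  gcongr
  rw [symbolAt_pow, norm_pow, add_mul, one_mul, mul_assoc]
  refine add_le_add (by linarith [pow_nonneg (norm_nonneg (symbolAt Q ζ)) μ]) ((hb ζ).trans ?_)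
  gcongr
  exact one_add_pow_le (norm_nonneg _) μ

/-- Interpolation of the lower order symbols between the symbol and a constant. -/
lemma exists_interpolation_le {P : MvPolynomial (Fin n) ℂ} {N : ℕ} (hN : P.totalDegree ≤ N)
    {d : ℝ} (hd : 1 ≤ d) {β : Fin n →₀ ℕ} (hβ : β ≠ 0)
    (hP : ∃ C : ℝ, 0 < C ∧ ∀ ζ, ‖ζ‖ ^ ((β.degree : ℝ) / d) * ‖symbolAt (coeff β (taylor P)) ζ‖ ≤
      C * (1 + ‖symbolAt P ζ‖)) {κ R : ℝ} (hκ : 0 < κ) (hR : 1 ≤ R) :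
    ∃ C : ℝ, 0 < C ∧ ∀ h : ℝ, 0 < h → h ≤ R → ∀ ζ,
      (h ^ β.degree)⁻¹ * ‖symbolAt (coeff β (taylor P)) ζ‖ ≤
        κ * ‖symbolAt P ζ‖ + C * h ^ (-(d * N)) := by
  have hd0 : 0 < d := by linarith
  rcases lt_or_ge N β.degree with hNb | hbN
  · refine ⟨1, one_pos, fun h hh _ ζ => ?_⟩
    rw [coeff_taylor_eq_zero hN hNb]
    simp only [symbolAt, map_zero, norm_zero, mul_zero]
    positivity
  obtain ⟨C₁, hC₁, hP⟩ := hP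
  obtain ⟨C₂, hC₂, hP₂⟩ := exists_norm_symbolAt_le (coeff β (taylor P)) (N := N - β.degree) <| by
    intro θ hθ
    by_contra hlt
    exact mem_support_iff.1 hθ (bidegreeLE_taylor hN β θ (by omega))
  set b := β.degree with hb
  have hb1 : 1 ≤ b := by
    rw [Nat.one_le_iff_ne_zero, hb, Ne, Finsupp.degree_eq_zero_iff]; exact hβ
  -- The threshold `l/h` for `|ζ|^{1/d}` is taken so high that the symbol estimate gains the factor
  -- `C₁ / l ≤ κ`.
  set l := max 1 (C₁ / κ) with hl
  have hl1 : 1 ≤ l := le_max_left _ _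
  have hl0 : 0 < l := by linarith
  have hlκ : C₁ ≤ κ * l := by
    rw [mul_comm, ← div_le_iff₀ hκ]; exact le_max_right _ _
  set A := 2 * l * R with hA
  have hA1 : 1 ≤ A := by nlinarith
  refine ⟨κ * R ^ (d * N) + C₂ * A ^ (d * N - b), by positivity, fun h hh hhR ζ => ?_⟩
  have hγ : 0 ≤ d * N := by positivity
  rcases le_or_gt (l / h) (‖ζ‖ ^ (1 / d)) with hc | hc
  · have h1 : l / h ^ b ≤ ‖ζ‖ ^ ((b : ℝ) / d) := by
      have : ‖ζ‖ ^ ((b : ℝ) / d) = (‖ζ‖ ^ (1 / d)) ^ b := by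
        rw [← Real.rpow_natCast, ← Real.rpow_mul (norm_nonneg _)]; congr 1; ring
      rw [this]
      refine le_trans ?_ (pow_le_pow_left₀ (by positivity) hc b)
      rw [div_pow]
      gcongr
      exact le_self_pow₀ hl1 (by omega)
    have h2 : l * ((h ^ b)⁻¹ * ‖symbolAt (coeff β (taylor P)) ζ‖) ≤
        l * (κ * (1 + ‖symbolAt P ζ‖)) := by
      calc _ = l / h ^ b * ‖symbolAt (coeff β (taylor P)) ζ‖ := by ring
        _ ≤ _ := mul_le_mul_of_nonneg_right h1 (norm_nonneg _)
        _ ≤ _ := hP ζ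
        _ ≤ (κ * l) * (1 + ‖symbolAt P ζ‖) := by gcongr
        _ = _ := by ring
    have h3 := le_of_mul_le_mul_left h2 hl0
    -- High frequencies leave a bare constant `κ`; it is absorbed in `h^{-dN}` because `h ≤ R`.
    have h4 : 1 ≤ R ^ (d * N) * h ^ (-(d * N)) := by
      rw [Real.rpow_neg hh.le, ← div_eq_mul_inv, ← Real.div_rpow (by linarith) hh.le]
      exact Real.one_le_rpow ((one_le_div hh).2 hhR) hγ
    have h5 : 0 ≤ C₂ * A ^ (d * N - b) * h ^ (-(d * N)) := by positivity
    nlinarith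
  -- Low frequencies: only the degree of the coefficient is used. Both summands are at most
  -- `(lR/h)^d`, and `2 ≤ 2^d` explains the factor 2 in `A`.
  · have hζ : 1 + ‖ζ‖ ≤ (A / h) ^ d := by
      have h1 : ‖ζ‖ ≤ (l / h) ^ d := by
        have := Real.rpow_le_rpow (by positivity) hc.le hd0.le
        rwa [← Real.rpow_mul (norm_nonneg _), one_div_mul_cancel hd0.ne', Real.rpow_one] at this
      have h2 : 1 ≤ (R / h) ^ d := Real.one_le_rpow ((one_le_div hh).2 hhR) hd0.le
      have h3 : (l / h) ^ d ≤ (l * R / h) ^ d := by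
        gcongr; exact le_mul_of_one_le_right hl0.le hR
      have h4 : (R / h) ^ d ≤ (l * R / h) ^ d := by
        gcongr; exact le_mul_of_one_le_left (by linarith) hl1
      have h5 : (A / h) ^ d = 2 ^ d * (l * R / h) ^ d := by
        rw [← Real.mul_rpow (by norm_num) (by positivity)]; congr 1; rw [hA]; ring
      have h6 : (2 : ℝ) ≤ 2 ^ d := Real.self_le_rpow_of_one_le (by norm_num) hd
      have h7 : 0 ≤ (l * R / h) ^ d := by positivity
      rw [h5]
      nlinarith
    have hAh : 1 ≤ A / h := by
      rw [one_le_div hh]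
      nlinarith
    have h1 : ‖symbolAt (coeff β (taylor P)) ζ‖ ≤ C₂ * (A / h) ^ (d * N - b) := by
      refine (hP₂ ζ).trans ?_
      gcongr
      refine (pow_le_pow_left₀ (by positivity) hζ _).trans ?_
      rw [← Real.rpow_natCast, ← Real.rpow_mul (by positivity)]
      -- Since `d ≥ 1`, `d(N - b) ≤ dN - b`; the spare `h^b` then cancels the weight `h^{-b}`.
      refine Real.rpow_le_rpow_of_exponent_le hAh ?_
      rw [Nat.cast_sub hbN]
      have : (b : ℝ) ≤ d * b := le_mul_of_one_le_left (by positivity) hd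
      linarith
    calc _ ≤ (h ^ b)⁻¹ * (C₂ * (A / h) ^ (d * N - b)) := by gcongr
      _ = C₂ * A ^ (d * N - b) * h ^ (-(d * N)) := by
        rw [Real.div_rpow (by positivity) hh.le, Real.rpow_sub hh, Real.rpow_neg hh.le,
          Real.rpow_natCast]
        field_simp
      _ ≤ _ := by
        rw [add_mul]
        have : 0 ≤ κ * R ^ (d * N) * h ^ (-(d * N)) := by positivity
        have : 0 ≤ κ * ‖symbolAt P ζ‖ := by positivity
        linarith

/-! ### Constant coefficient operators as Fourier multipliers -/

/-- The symbol in Mathlib's normalisation of the frequency variable. -/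
def freqSymbol (R : MvPolynomial (Fin n) ℂ) (ξ : EuclideanSpace ℝ (Fin n)) : ℂ :=
  symbolAt R ((2 * Real.pi) • ξ)

lemma hasTemperateGrowth_freqSymbol (R : MvPolynomial (Fin n) ℂ) :
    (freqSymbol R).HasTemperateGrowth := by
  induction R using MvPolynomial.induction_on with
  | C c =>
    have : freqSymbol (C c) = fun _ : EuclideanSpace ℝ (Fin n) => c := by
      funext ξ; simp [freqSymbol, symbolAt]
    rw [this]; exact Function.HasTemperateGrowth.const c
  | add p q hp hq =>
    have : freqSymbol (p + q) = freqSymbol p + freqSymbol q := by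
      funext ξ; simp [freqSymbol, symbolAt]
    rw [this]; exact hp.add hq
  | mul_X p j hp =>
    have : freqSymbol (p * X j) = fun ξ => freqSymbol p ξ *
        Complex.ofRealCLM (((2 * Real.pi) • EuclideanSpace.proj (𝕜 := ℝ) j) ξ) := by
      funext ξ; simp [freqSymbol, symbolAt]
    rw [this]
    exact hp.mul ((Complex.ofRealCLM ∘L ((2 * Real.pi) • EuclideanSpace.proj j)).hasTemperateGrowth)

/-- The operator `R(D)` on Schwartz functions. -/
def op (R : MvPolynomial (Fin n) ℂ) :
    𝓢(EuclideanSpace ℝ (Fin n), ℂ) →L[ℂ] 𝓢(EuclideanSpace ℝ (Fin n), ℂ) :=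
  SchwartzMap.fourierMultiplierCLM ℂ (freqSymbol R)

lemma fourier_op (R : MvPolynomial (Fin n) ℂ) (f : 𝓢(EuclideanSpace ℝ (Fin n), ℂ))
    (ξ : EuclideanSpace ℝ (Fin n)) : 𝓕 (op R f) ξ = freqSymbol R ξ * 𝓕 f ξ := by
  rw [op, SchwartzMap.fourierMultiplierCLM_apply, FourierTransform.fourier_fourierInv_eq,
    SchwartzMap.smulLeftCLM_apply_apply (hasTemperateGrowth_freqSymbol R), smul_eq_mul]

lemma schwartz_ext_fourier {f g : 𝓢(EuclideanSpace ℝ (Fin n), ℂ)} (h : ∀ ξ, 𝓕 f ξ = 𝓕 g ξ) : f = g := by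
  have : 𝓕 f = 𝓕 g := SchwartzMap.ext h
  rw [← FourierTransform.fourierInv_fourier_eq (F := 𝓢(EuclideanSpace ℝ (Fin n), ℂ)) f, this,
    FourierTransform.fourierInv_fourier_eq]

lemma op_add (R S : MvPolynomial (Fin n) ℂ) (f : 𝓢(EuclideanSpace ℝ (Fin n), ℂ)) :
    op (R + S) f = op R f + op S f :=
  schwartz_ext_fourier fun ξ => by
    rw [FourierTransform.fourier_add, _root_.add_apply]
    simp only [fourier_op, freqSymbol, symbolAt_add, add_mul]

lemma op_mul (R S : MvPolynomial (Fin n) ℂ) (f : 𝓢(EuclideanSpace ℝ (Fin n), ℂ)) :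
    op (R * S) f = op R (op S f) :=
  schwartz_ext_fourier fun ξ => by
    simp only [fourier_op, freqSymbol, symbolAt_mul, mul_assoc]

lemma op_C (c : ℂ) (f : 𝓢(EuclideanSpace ℝ (Fin n), ℂ)) : op (C c) f = c • f :=
  schwartz_ext_fourier fun ξ => by
    rw [FourierTransform.fourier_smul, _root_.smul_apply]
    simp [fourier_op, freqSymbol, symbolAt]

lemma op_one (f : 𝓢(EuclideanSpace ℝ (Fin n), ℂ)) : op 1 f = f := by
  simpa using op_C 1 f

lemma op_zero (f : 𝓢(EuclideanSpace ℝ (Fin n), ℂ)) : op 0 f = 0 := by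
  simpa using op_C 0 f

lemma op_comm (R S : MvPolynomial (Fin n) ℂ) (f : 𝓢(EuclideanSpace ℝ (Fin n), ℂ)) :
    op R (op S f) = op S (op R f) := by
  rw [← op_mul, mul_comm, op_mul]

lemma op_sum {ι : Type*} (s : Finset ι) (R : ι → MvPolynomial (Fin n) ℂ)
    (f : 𝓢(EuclideanSpace ℝ (Fin n), ℂ)) :
    op (∑ i ∈ s, R i) f = ∑ i ∈ s, op (R i) f := by
  classical
  induction s using Finset.induction_on with
  | empty => simp [op_zero]
  | insert a s ha ih => rw [Finset.sum_insert ha, Finset.sum_insert ha, op_add, ih]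

lemma op_X (j : Fin n) (f : 𝓢(EuclideanSpace ℝ (Fin n), ℂ)) :
    op (X j) f = -Complex.I • ∂_{EuclideanSpace.single j (1 : ℝ)} f :=
  schwartz_ext_fourier fun ξ => by
    rw [FourierTransform.fourier_smul, _root_.smul_apply, SchwartzMap.fourier_lineDerivOp_eq,
      _root_.smul_apply, SchwartzMap.smulLeftCLM_apply_apply (by fun_prop), fourier_op]
    simp only [freqSymbol, symbolAt, eval_X, PiLp.smul_apply, smul_eq_mul, Complex.ofReal_mul,
      Complex.real_smul, EuclideanSpace.inner_single_right]
    simp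
    linear_combination (2 * Real.pi * ξ j * 𝓕 f ξ : ℂ) * Complex.I_sq

lemma coe_op_X (j : Fin n) (f : 𝓢(EuclideanSpace ℝ (Fin n), ℂ)) :
    ⇑(op (X j) f) = partialD j f := by
  funext x
  rw [op_X]
  simp [partialD, SchwartzMap.lineDerivOp_apply_eq_fderiv]

lemma coe_op_X_pow (j : Fin n) (k : ℕ) (f : 𝓢(EuclideanSpace ℝ (Fin n), ℂ)) :
    ⇑(op (X j ^ k) f) = (partialD j)^[k] f := by
  induction k with
  | zero => simp [op_one]
  | succ k ih => rw [pow_succ', op_mul, coe_op_X, ih, Function.iterate_succ_apply']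

lemma coe_op_prod (α : Fin n →₀ ℕ) (l : List (Fin n)) (f : 𝓢(EuclideanSpace ℝ (Fin n), ℂ)) :
    ⇑(op (l.map fun j => X j ^ α j).prod f) =
      l.foldr (fun j v => (partialD j)^[α j] v) f := by
  induction l with
  | nil => simp [op_one]
  | cons j l ih => rw [List.map_cons, List.prod_cons, op_mul, coe_op_X_pow, ih, List.foldr_cons]

lemma coe_op_monomial (α : Fin n →₀ ℕ) (f : 𝓢(EuclideanSpace ℝ (Fin n), ℂ)) :
    ⇑(op (monomial α 1) f) = multiD α f := by
  rw [multiD, ← coe_op_prod, ← List.ofFn_eq_map, List.prod_ofFn, monomial_eq, C_1, one_mul,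
    Finsupp.prod_fintype _ _ (by simp)]

/-- As Fourier multipliers the operators obey the algebra of symbols and Plancherel; this identity
brings back the differential operators of the statement. -/
lemma coe_op (R : MvPolynomial (Fin n) ℂ) (f : 𝓢(EuclideanSpace ℝ (Fin n), ℂ)) :
    ⇑(op R f) = diffOp R f := by
  funext x
  conv_lhs => rw [R.as_sum]
  rw [op_sum, _root_.sum_apply, diffOp]
  refine Finset.sum_congr rfl fun α _ => ?_
  have : monomial α (coeff α R) = C (coeff α R) * monomial α 1 := by
    rw [C_mul_monomial, mul_one]
  rw [this, op_mul, op_C, _root_.smul_apply, coe_op_monomial, smul_eq_mul]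

lemma coe_op_pow (R : MvPolynomial (Fin n) ℂ) (k : ℕ) (f : 𝓢(EuclideanSpace ℝ (Fin n), ℂ)) :
    ⇑(op (R ^ k) f) = (diffOp R)^[k] f := by
  induction k with
  | zero => simp [op_one]
  | succ k ih => rw [pow_succ', op_mul, coe_op, ih, Function.iterate_succ_apply']

/-! ### The Leibniz formula -/

/-- Pointwise product of Schwartz functions. -/
def mulS (φ v : 𝓢(EuclideanSpace ℝ (Fin n), ℂ)) : 𝓢(EuclideanSpace ℝ (Fin n), ℂ) :=
  SchwartzMap.pairing (ContinuousLinearMap.mul ℂ ℂ) φ v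

@[simp] lemma mulS_apply (φ v : 𝓢(EuclideanSpace ℝ (Fin n), ℂ)) (x : EuclideanSpace ℝ (Fin n)) :
    mulS φ v x = φ x * v x := rfl

lemma op_X_mulS (j : Fin n) (φ v : 𝓢(EuclideanSpace ℝ (Fin n), ℂ)) :
    op (X j) (mulS φ v) = mulS (op (X j) φ) v + mulS φ (op (X j) v) := by
  ext x
  have h : ⇑(mulS φ v) = fun x => φ x * v x := rfl
  simp only [_root_.add_apply, mulS_apply, coe_op_X, partialD]
  rw [h, fderiv_fun_mul φ.differentiableAt v.differentiableAt]
  simp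
  ring

lemma mulS_add (φ v w : 𝓢(EuclideanSpace ℝ (Fin n), ℂ)) :
    mulS φ (v + w) = mulS φ v + mulS φ w := by
  ext x; simp [mul_add]

lemma mulS_zero (φ : 𝓢(EuclideanSpace ℝ (Fin n), ℂ)) : mulS φ 0 = 0 := by
  ext x; simp

/-- `∑_β (D^β φ) · S_β(D) v`. -/
def leibnizSum (φ v : 𝓢(EuclideanSpace ℝ (Fin n), ℂ))
    (S : MvPolynomial (Fin n) (MvPolynomial (Fin n) ℂ)) : 𝓢(EuclideanSpace ℝ (Fin n), ℂ) :=
  ∑ β ∈ S.support, mulS (op (monomial β 1) φ) (op (coeff β S) v)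

lemma leibnizSum_add (φ v : 𝓢(EuclideanSpace ℝ (Fin n), ℂ))
    (S S' : MvPolynomial (Fin n) (MvPolynomial (Fin n) ℂ)) :
    leibnizSum φ v (S + S') = leibnizSum φ v S + leibnizSum φ v S' := by
  classical
  have h : ∀ (S : MvPolynomial (Fin n) (MvPolynomial (Fin n) ℂ)) (F : Finset (Fin n →₀ ℕ)),
      S.support ⊆ F → leibnizSum φ v S =
        ∑ β ∈ F, mulS (op (monomial β 1) φ) (op (coeff β S) v) := fun S F hF =>
    Finset.sum_subset hF fun β _ hβ => by
      rw [notMem_support_iff.1 hβ, op_zero, mulS_zero]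
  rw [h (S + S') (S.support ∪ S'.support) support_add, h S _ Finset.subset_union_left,
    h S' _ Finset.subset_union_right, ← Finset.sum_add_distrib]
  refine Finset.sum_congr rfl fun β _ => ?_
  rw [coeff_add, op_add, mulS_add]

lemma leibnizSum_monomial (φ v : 𝓢(EuclideanSpace ℝ (Fin n), ℂ)) (β : Fin n →₀ ℕ)
    (r : MvPolynomial (Fin n) ℂ) :
    leibnizSum φ v (monomial β r) = mulS (op (monomial β 1) φ) (op r v) := by
  classical
  rw [leibnizSum]
  by_cases hr : r = 0
  · simp [hr, op_zero, mulS_zero]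
  · rw [support_monomial, if_neg hr, Finset.sum_singleton, coeff_monomial, if_pos rfl]

/-- By the product rule, `D_j` either falls on `v`, multiplying the coefficients by `X_j`, or on
`φ`, which raises the outer index. Hence Leibniz sums for `P(D)` are governed by `P(X + Y)`. -/
lemma op_X_leibnizSum (φ v : 𝓢(EuclideanSpace ℝ (Fin n), ℂ)) (j : Fin n)
    (S : MvPolynomial (Fin n) (MvPolynomial (Fin n) ℂ)) :
    op (X j) (leibnizSum φ v S) = leibnizSum φ v ((C (X j) + X j) * S) := by
  induction S using MvPolynomial.induction_on' with
  | monomial β r =>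
    have h1 : (X j : MvPolynomial (Fin n) (MvPolynomial (Fin n) ℂ)) * monomial β r =
        monomial (Finsupp.single j 1 + β) r := by rw [X, monomial_mul, one_mul]
    have h2 : (monomial (Finsupp.single j 1 + β) 1 : MvPolynomial (Fin n) ℂ) =
        X j * monomial β 1 := by rw [X, monomial_mul, one_mul]
    rw [add_mul, leibnizSum_add, C_mul_monomial, h1, leibnizSum_monomial, leibnizSum_monomial,
      leibnizSum_monomial, op_X_mulS, h2, op_mul, op_mul, add_comm]
  | add p q hp hq => rw [leibnizSum_add, map_add, hp, hq, mul_add, leibnizSum_add]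

/-- The general Leibniz formula. -/
lemma op_mulS (P : MvPolynomial (Fin n) ℂ) (φ v : 𝓢(EuclideanSpace ℝ (Fin n), ℂ)) :
    op P (mulS φ v) = leibnizSum φ v (taylor P) := by
  induction P using MvPolynomial.induction_on with
  | C c =>
    rw [taylor_C, op_C, ← monomial_zero', leibnizSum_monomial, op_C]
    have : (monomial 0 1 : MvPolynomial (Fin n) ℂ) = 1 := rfl
    rw [this, op_one]
    ext x
    simp; ring
  | add p q hp hq => rw [op_add, hp, hq, map_add, leibnizSum_add]
  | mul_X p j hp => rw [mul_comm, op_mul, hp, op_X_leibnizSum, map_mul, taylor_X]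

/-! ### Locality of differential operators -/

lemma partialD_eqOn {U : Set (EuclideanSpace ℝ (Fin n))} (hU : IsOpen U) (j : Fin n)
    {f g : EuclideanSpace ℝ (Fin n) → ℂ} (h : Set.EqOn f g U) :
    Set.EqOn (partialD j f) (partialD j g) U := fun x hx => by
  have : f =ᶠ[nhds x] g := h.eventuallyEq_of_mem (hU.mem_nhds hx)
  simp only [partialD, this.fderiv_eq]

lemma partialD_iterate_eqOn {U : Set (EuclideanSpace ℝ (Fin n))} (hU : IsOpen U) (j : Fin n)
    (k : ℕ) {f g : EuclideanSpace ℝ (Fin n) → ℂ} (h : Set.EqOn f g U) :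
    Set.EqOn ((partialD j)^[k] f) ((partialD j)^[k] g) U := by
  induction k with
  | zero => simpa using h
  | succ k ih =>
    simp only [Function.iterate_succ_apply']
    exact partialD_eqOn hU j ih

lemma multiD_eqOn {U : Set (EuclideanSpace ℝ (Fin n))} (hU : IsOpen U) (α : Fin n →₀ ℕ)
    {f g : EuclideanSpace ℝ (Fin n) → ℂ} (h : Set.EqOn f g U) :
    Set.EqOn (multiD α f) (multiD α g) U := by
  rw [multiD, multiD]
  induction List.finRange n with
  | nil => simpa using h
  | cons j l ih => exact partialD_iterate_eqOn hU j _ ih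

lemma diffOp_eqOn {U : Set (EuclideanSpace ℝ (Fin n))} (hU : IsOpen U)
    (R : MvPolynomial (Fin n) ℂ) {f g : EuclideanSpace ℝ (Fin n) → ℂ} (h : Set.EqOn f g U) :
    Set.EqOn (diffOp R f) (diffOp R g) U := fun x hx =>
  Finset.sum_congr rfl fun α _ => by rw [multiD_eqOn hU α h hx]

lemma diffOp_iterate_eqOn {U : Set (EuclideanSpace ℝ (Fin n))} (hU : IsOpen U)
    (R : MvPolynomial (Fin n) ℂ) (k : ℕ) {f g : EuclideanSpace ℝ (Fin n) → ℂ}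
    (h : Set.EqOn f g U) : Set.EqOn ((diffOp R)^[k] f) ((diffOp R)^[k] g) U := by
  induction k with
  | zero => simpa using h
  | succ k ih =>
    simp only [Function.iterate_succ_apply']
    exact diffOp_eqOn hU R ih

lemma op_eqOn {U : Set (EuclideanSpace ℝ (Fin n))} (hU : IsOpen U)
    (R : MvPolynomial (Fin n) ℂ) {f g : 𝓢(EuclideanSpace ℝ (Fin n), ℂ)} (h : Set.EqOn f g U) :
    Set.EqOn (op R f) (op R g) U := by
  rw [coe_op, coe_op]
  exact diffOp_eqOn hU R h

/-! ### Real-valued local norms and Plancherel -/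

/-- The `L²(S)` norm of a Schwartz function, as a real number. -/
def nrm (S : Set (EuclideanSpace ℝ (Fin n))) (f : 𝓢(EuclideanSpace ℝ (Fin n), ℂ)) : ℝ :=
  (l2Norm S f).toReal

lemma l2Norm_ne_top (S : Set (EuclideanSpace ℝ (Fin n))) (f : 𝓢(EuclideanSpace ℝ (Fin n), ℂ)) :
    l2Norm S f ≠ ∞ :=
  ((f.memLp 2 volume).restrict S).eLpNorm_ne_top

lemma ofReal_nrm (S : Set (EuclideanSpace ℝ (Fin n))) (f : 𝓢(EuclideanSpace ℝ (Fin n), ℂ)) :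
    ENNReal.ofReal (nrm S f) = l2Norm S f := ENNReal.ofReal_toReal (l2Norm_ne_top S f)

lemma nrm_nonneg (S : Set (EuclideanSpace ℝ (Fin n))) (f : 𝓢(EuclideanSpace ℝ (Fin n), ℂ)) :
    0 ≤ nrm S f := ENNReal.toReal_nonneg

lemma l2Norm_mono {S S' : Set (EuclideanSpace ℝ (Fin n))} (h : S ⊆ S')
    (f : EuclideanSpace ℝ (Fin n) → ℂ) : l2Norm S f ≤ l2Norm S' f :=
  eLpNorm_mono_measure _ (Measure.restrict_mono h le_rfl)

lemma l2Norm_congr {S : Set (EuclideanSpace ℝ (Fin n))} (hS : MeasurableSet S)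
    {f g : EuclideanSpace ℝ (Fin n) → ℂ} (h : Set.EqOn f g S) : l2Norm S f = l2Norm S g :=
  eLpNorm_congr_ae ((ae_restrict_iff' hS).2 (Filter.Eventually.of_forall h))

lemma nrm_mono {S S' : Set (EuclideanSpace ℝ (Fin n))} (h : S ⊆ S')
    (f : 𝓢(EuclideanSpace ℝ (Fin n), ℂ)) : nrm S f ≤ nrm S' f :=
  ENNReal.toReal_mono (l2Norm_ne_top _ _) (l2Norm_mono h f)

lemma nrm_le_of_eqOn {S : Set (EuclideanSpace ℝ (Fin n))} (hS : MeasurableSet S)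
    {f g : 𝓢(EuclideanSpace ℝ (Fin n), ℂ)} (h : Set.EqOn f g S) :
    nrm S f ≤ nrm Set.univ g := by
  rw [nrm, l2Norm_congr hS h]
  exact nrm_mono (Set.subset_univ _) g

lemma nrm_add_le (S : Set (EuclideanSpace ℝ (Fin n))) (f g : 𝓢(EuclideanSpace ℝ (Fin n), ℂ)) :
    nrm S (f + g) ≤ nrm S f + nrm S g := by
  rw [nrm, nrm, nrm, ← ENNReal.toReal_add (l2Norm_ne_top _ _) (l2Norm_ne_top _ _)]
  refine ENNReal.toReal_mono (ENNReal.add_ne_top.2 ⟨l2Norm_ne_top _ _, l2Norm_ne_top _ _⟩) ?_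
  exact eLpNorm_add_le f.continuous.aestronglyMeasurable g.continuous.aestronglyMeasurable
    (by norm_num)

lemma nrm_sum_le {ι : Type*} (S : Set (EuclideanSpace ℝ (Fin n))) (s : Finset ι)
    (f : ι → 𝓢(EuclideanSpace ℝ (Fin n), ℂ)) :
    nrm S (∑ i ∈ s, f i) ≤ ∑ i ∈ s, nrm S (f i) := by
  classical
  induction s using Finset.induction_on with
  | empty => simp [nrm, l2Norm]
  | insert a s ha ih =>
    rw [Finset.sum_insert ha, Finset.sum_insert ha]
    exact (nrm_add_le _ _ _).trans (by gcongr)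

lemma nrm_mulS_le {S : Set (EuclideanSpace ℝ (Fin n))} (hS : MeasurableSet S)
    {φ : 𝓢(EuclideanSpace ℝ (Fin n), ℂ)} {K : ℝ} (hK : 0 ≤ K) (hφ : ∀ x, ‖φ x‖ ≤ K)
    (hφS : ∀ x ∉ S, φ x = 0) (v : 𝓢(EuclideanSpace ℝ (Fin n), ℂ)) :
    nrm Set.univ (mulS φ v) ≤ K * nrm S v := by
  have h : l2Norm Set.univ (mulS φ v) ≤ ENNReal.ofReal K * l2Norm S v := by
    rw [l2Norm, Measure.restrict_univ, l2Norm, ← eLpNorm_indicator_eq_eLpNorm_restrict hS]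
    refine eLpNorm_le_mul_eLpNorm_of_ae_le_mul (Filter.Eventually.of_forall fun x => ?_) 2
    rw [mulS_apply, norm_mul]
    by_cases hx : x ∈ S
    · rw [Set.indicator_of_mem hx]
      gcongr
      exact hφ x
    · simp [hφS x hx, Set.indicator_of_notMem hx]
  rw [nrm, nrm]
  have := ENNReal.toReal_mono (ENNReal.mul_ne_top ENNReal.ofReal_ne_top (l2Norm_ne_top _ _)) h
  rwa [ENNReal.toReal_mul, ENNReal.toReal_ofReal hK] at this

lemma nrm_univ_eq (f : 𝓢(EuclideanSpace ℝ (Fin n), ℂ)) : nrm Set.univ f = ‖f.toLp 2‖ := by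
  rw [nrm, l2Norm, Measure.restrict_univ, SchwartzMap.norm_toLp]

lemma nrm_fourier (f : 𝓢(EuclideanSpace ℝ (Fin n), ℂ)) :
    nrm Set.univ (𝓕 f) = nrm Set.univ f := by
  rw [nrm_univ_eq, nrm_univ_eq, SchwartzMap.norm_fourier_toL2_eq]

lemma nrm_univ_le_of_pointwise {F G H : 𝓢(EuclideanSpace ℝ (Fin n), ℂ)} {a κ c : ℝ}
    (ha : 0 ≤ a) (hκ : 0 ≤ κ) (hc : 0 ≤ c) (h : ∀ x, a * ‖F x‖ ≤ κ * ‖G x‖ + c * ‖H x‖) :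
    a * nrm Set.univ F ≤ κ * nrm Set.univ G + c * nrm Set.univ H := by
  have key : ENNReal.ofReal a * eLpNorm F 2 volume ≤
      ENNReal.ofReal κ * eLpNorm G 2 volume + ENNReal.ofReal c * eLpNorm H 2 volume := by
    have e : ∀ (b : ℝ) (hb : 0 ≤ b) (f : 𝓢(EuclideanSpace ℝ (Fin n), ℂ)),
        ENNReal.ofReal b * eLpNorm f 2 volume = eLpNorm (b • fun x => ‖f x‖) 2 volume := by
      intro b hb f
      rw [eLpNorm_const_smul, eLpNorm_norm, Real.enorm_eq_ofReal hb]
    rw [e a ha, e κ hκ, e c hc]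
    refine le_trans (eLpNorm_mono_real (g := (κ • fun x => ‖G x‖) + c • fun x => ‖H x‖)
      fun x => ?_) (eLpNorm_add_le ?_ ?_ (by norm_num))
    · simpa [abs_of_nonneg ha] using h x
    · exact (G.continuous.norm.const_smul κ).aestronglyMeasurable
    · exact (H.continuous.norm.const_smul c).aestronglyMeasurable
  have hG : eLpNorm G 2 volume ≠ ∞ := (G.memLp 2 volume).eLpNorm_ne_top
  have hH : eLpNorm H 2 volume ≠ ∞ := (H.memLp 2 volume).eLpNorm_ne_top
  have hG' := ENNReal.mul_ne_top (ENNReal.ofReal_ne_top (r := κ)) hG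
  have hH' := ENNReal.mul_ne_top (ENNReal.ofReal_ne_top (r := c)) hH
  have := ENNReal.toReal_mono (ENNReal.add_ne_top.2 ⟨hG', hH'⟩) key
  rw [ENNReal.toReal_add hG' hH', ENNReal.toReal_mul, ENNReal.toReal_mul, ENNReal.toReal_mul,
    ENNReal.toReal_ofReal ha, ENNReal.toReal_ofReal hκ, ENNReal.toReal_ofReal hc] at this
  simpa only [nrm, l2Norm, Measure.restrict_univ] using this

/-- Inequalities between symbols give `L²` inequalities between operators. -/
lemma nrm_op_le_of_symbol {R P : MvPolynomial (Fin n) ℂ} {a κ c : ℝ}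
    (ha : 0 ≤ a) (hκ : 0 ≤ κ) (hc : 0 ≤ c)
    (h : ∀ ζ, a * ‖symbolAt R ζ‖ ≤ κ * ‖symbolAt P ζ‖ + c) (f : 𝓢(EuclideanSpace ℝ (Fin n), ℂ)) :
    a * nrm Set.univ (op R f) ≤ κ * nrm Set.univ (op P f) + c * nrm Set.univ f := by
  rw [← nrm_fourier (op R f), ← nrm_fourier (op P f), ← nrm_fourier f]
  refine nrm_univ_le_of_pointwise ha hκ hc fun ξ => ?_
  rw [fourier_op, fourier_op, norm_mul, norm_mul]
  have := mul_le_mul_of_nonneg_right (h ((2 * Real.pi) • ξ)) (norm_nonneg (𝓕 f ξ))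
  simp only [freqSymbol]
  linarith

/-! ### Multi-index induction and shrinkings -/

lemma multiIndex_induction {p : (Fin n →₀ ℕ) → Prop} (h0 : p 0)
    (hs : ∀ β j, p β → p (β + Finsupp.single j 1)) (β : Fin n →₀ ℕ) : p β := by
  induction hN : β.degree generalizing β with
  | zero => rwa [(Finsupp.degree_eq_zero_iff β).1 hN]
  | succ N ih =>
    obtain ⟨j, hj⟩ : ∃ j, β j ≠ 0 := by
      by_contra! hc
      have : β = 0 := Finsupp.ext hc
      simp [this] at hN
    have hle : Finsupp.single j 1 ≤ β := by
      rw [Finsupp.single_le_iff]; omega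
    have hβ := tsub_add_cancel_of_le hle
    have hdeg : (β - Finsupp.single j 1).degree = N := by
      have := congrArg Finsupp.degree hβ
      rw [map_add, Finsupp.degree_single] at this
      omega
    rw [← hβ]
    exact hs _ j (ih _ hdeg)

lemma monomial_add_single_one (β : Fin n →₀ ℕ) (j : Fin n) :
    (monomial (β + Finsupp.single j 1) 1 : MvPolynomial (Fin n) ℂ) = X j * monomial β 1 := by
  rw [X, monomial_mul, one_mul, add_comm]

lemma monomial_zero_one : (monomial 0 1 : MvPolynomial (Fin n) ℂ) = 1 := rfl

lemma shrink_eq (ω : Set (EuclideanSpace ℝ (Fin n))) (s : ℝ) :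
    shrink ω s = {x | ENNReal.ofReal s < Metric.infEDist x ωᶜ} := by
  ext x
  refine ⟨fun h => h.2, fun h => ⟨?_, h⟩⟩
  by_contra hx
  have : Metric.infEDist x ωᶜ = 0 := Metric.infEDist_zero_of_mem hx
  simp [this] at h

lemma isOpen_shrink (ω : Set (EuclideanSpace ℝ (Fin n))) (s : ℝ) : IsOpen (shrink ω s) := by
  rw [shrink_eq]
  exact isOpen_lt continuous_const Metric.continuous_infEDist

lemma shrink_subset (ω : Set (EuclideanSpace ℝ (Fin n))) (s : ℝ) : shrink ω s ⊆ ω :=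
  fun _ h => h.1

lemma shrink_anti (ω : Set (EuclideanSpace ℝ (Fin n))) {s t : ℝ} (h : s ≤ t) :
    shrink ω t ⊆ shrink ω s :=
  fun _ hx => ⟨hx.1, (ENNReal.ofReal_le_ofReal h).trans_lt hx.2⟩

lemma mem_shrink_of_dist_lt {ω : Set (EuclideanSpace ℝ (Fin n))} {s r : ℝ} (hs : 0 ≤ s)
    {x y : EuclideanSpace ℝ (Fin n)} (hx : x ∈ shrink ω (s + r)) (hxy : dist x y < r) :
    y ∈ shrink ω s := by
  have hr : 0 ≤ r := dist_nonneg.trans hxy.le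
  rw [shrink_eq] at hx ⊢
  have h1 : Metric.infEDist x ωᶜ ≤ Metric.infEDist y ωᶜ + edist x y :=
    Metric.infEDist_le_infEDist_add_edist
  have h2 : edist x y ≤ ENNReal.ofReal r := by
    rw [edist_dist]; exact ENNReal.ofReal_le_ofReal hxy.le
  rw [Set.mem_ofPred_eq, ENNReal.ofReal_add hs hr] at hx
  have h3 := hx.trans_le (h1.trans (add_le_add_right h2 _))
  exact (ENNReal.add_lt_add_iff_right ENNReal.ofReal_ne_top).1 h3

/-! ### Cutoff functions with uniform derivative bounds -/

/-- Convolution of the indicator function of `A` with `g`. -/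
def convInd (A : Set (EuclideanSpace ℝ (Fin n))) (g : EuclideanSpace ℝ (Fin n) → ℂ) :
    EuclideanSpace ℝ (Fin n) → ℂ :=
  A.indicator (fun _ => (1 : ℝ)) ⋆[ContinuousLinearMap.lsmul ℝ ℝ, volume] g

lemma convInd_apply {A : Set (EuclideanSpace ℝ (Fin n))} (hA : MeasurableSet A)
    (g : EuclideanSpace ℝ (Fin n) → ℂ) (x : EuclideanSpace ℝ (Fin n)) :
    convInd A g x = ∫ y in A, g (x - y) := by
  rw [convInd, convolution_lsmul, ← integral_indicator hA]
  congr 1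
  funext y
  by_cases hy : y ∈ A <;> simp [hy]

lemma hasCompactSupport_op (R : MvPolynomial (Fin n) ℂ) {g : 𝓢(EuclideanSpace ℝ (Fin n), ℂ)}
    (hg : HasCompactSupport g) : HasCompactSupport (op R g) := by
  refine HasCompactSupport.intro hg fun x hx => ?_
  have h : Set.EqOn g (0 : 𝓢(EuclideanSpace ℝ (Fin n), ℂ)) (tsupport g)ᶜ := fun y hy => by
    simpa using image_eq_zero_of_notMem_tsupport hy
  simpa using op_eqOn (isClosed_tsupport g).isOpen_compl R h hx

lemma locallyIntegrable_indicator {A : Set (EuclideanSpace ℝ (Fin n))} (hA : MeasurableSet A) :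
    LocallyIntegrable (A.indicator fun _ => (1 : ℝ)) volume :=
  (locallyIntegrable_const 1).indicator hA

/-- The indicator is merely locally integrable, so the derivative is made to fall on the smooth
factor. -/
lemma op_X_convInd {A : Set (EuclideanSpace ℝ (Fin n))} (hA : MeasurableSet A) (j : Fin n)
    {g ψ : 𝓢(EuclideanSpace ℝ (Fin n), ℂ)} (hg : HasCompactSupport g) (h : ⇑ψ = convInd A g) :
    ⇑(op (X j) ψ) = convInd A (op (X j) g) := by
  have hloc := locallyIntegrable_indicator hA
  funext x
  rw [coe_op_X, coe_op_X, partialD, h, convInd,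
    (hg.hasFDerivAt_convolution_right (ContinuousLinearMap.lsmul ℝ ℝ) hloc
      (g.smooth 1) x).fderiv,
    convolution_precompR_apply _ hloc (hg.fderiv ℝ) ((g.smooth 1).continuous_fderiv one_ne_zero)]
  rw [convInd, convolution_lsmul, convolution_lsmul, ← integral_const_mul]
  refine integral_congr_ae (Filter.Eventually.of_forall fun y => ?_)
  simp only [partialD, Complex.real_smul]
  ring

lemma op_monomial_convInd {A : Set (EuclideanSpace ℝ (Fin n))} (hA : MeasurableSet A)
    {g ψ : 𝓢(EuclideanSpace ℝ (Fin n), ℂ)} (hg : HasCompactSupport g) (h : ⇑ψ = convInd A g)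
    (β : Fin n →₀ ℕ) : ⇑(op (monomial β 1) ψ) = convInd A (op (monomial β 1) g) := by
  induction β using multiIndex_induction with
  | h0 => rw [monomial_zero_one, op_one, op_one, h]
  | hs β j ih =>
    rw [monomial_add_single_one, op_mul, op_mul]
    exact op_X_convInd hA j (hasCompactSupport_op _ hg) ih

lemma norm_convInd_le {A : Set (EuclideanSpace ℝ (Fin n))} (hA : MeasurableSet A)
    (g : 𝓢(EuclideanSpace ℝ (Fin n), ℂ)) (x : EuclideanSpace ℝ (Fin n)) :
    ‖convInd A g x‖ ≤ ∫ y, ‖g y‖ := by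
  rw [convInd_apply hA]
  refine (norm_integral_le_integral_norm _).trans ?_
  rw [← integral_sub_left_eq_self (fun y => ‖g y‖) volume x]
  exact setIntegral_le_integral ((g.integrable (μ := volume)).norm.comp_sub_left x)
    (Filter.Eventually.of_forall fun _ => norm_nonneg _)

/-- Dilation by `h⁻¹`. -/
def dilate {h : ℝ} (hh : h ≠ 0) :
    𝓢(EuclideanSpace ℝ (Fin n), ℂ) →L[ℂ] 𝓢(EuclideanSpace ℝ (Fin n), ℂ) :=
  SchwartzMap.compCLMOfContinuousLinearEquiv ℂ
    (ContinuousLinearEquiv.smulLeft (Units.mk0 h⁻¹ (inv_ne_zero hh)))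

lemma dilate_apply {h : ℝ} (hh : h ≠ 0) (f : 𝓢(EuclideanSpace ℝ (Fin n), ℂ))
    (x : EuclideanSpace ℝ (Fin n)) : dilate hh f x = f (h⁻¹ • x) := rfl

lemma op_X_dilate {h : ℝ} (hh : h ≠ 0) (j : Fin n) (f : 𝓢(EuclideanSpace ℝ (Fin n), ℂ)) :
    op (X j) (dilate hh f) = ((h⁻¹ : ℝ) : ℂ) • dilate hh (op (X j) f) := by
  ext x
  rw [_root_.smul_apply, dilate_apply, op_X, op_X, dilate,
    SchwartzMap.lineDerivOp_compCLMOfContinuousLinearEquiv]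
  simp only [_root_.smul_apply, SchwartzMap.compCLMOfContinuousLinearEquiv_apply,
    Function.comp, SchwartzMap.lineDerivOp_apply_eq_fderiv]
  have : (ContinuousLinearEquiv.smulLeft (R₁ := ℝ) (M₁ := EuclideanSpace ℝ (Fin n))
    (Units.mk0 h⁻¹ (inv_ne_zero hh))) (EuclideanSpace.single j (1 : ℝ)) =
      h⁻¹ • EuclideanSpace.single j (1 : ℝ) := rfl
  rw [this, map_smul]
  have : (ContinuousLinearEquiv.smulLeft (R₁ := ℝ) (M₁ := EuclideanSpace ℝ (Fin n))
    (Units.mk0 h⁻¹ (inv_ne_zero hh))) x = h⁻¹ • x := rfl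
  rw [this]
  simp only [Complex.real_smul, smul_eq_mul]
  ring

lemma op_monomial_dilate {h : ℝ} (hh : h ≠ 0) (β : Fin n →₀ ℕ)
    (f : 𝓢(EuclideanSpace ℝ (Fin n), ℂ)) :
    op (monomial β 1) (dilate hh f) =
      (((h ^ β.degree)⁻¹ : ℝ) : ℂ) • dilate hh (op (monomial β 1) f) := by
  induction β using multiIndex_induction with
  | h0 => simp [monomial_zero_one, op_one]
  | hs β j ih =>
    rw [monomial_add_single_one, op_mul, op_mul, ih, map_smul, op_X_dilate, smul_smul,
      ← Complex.ofReal_mul, map_add, Finsupp.degree_single, pow_succ, mul_inv]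

lemma exists_bump (n : ℕ) : ∃ ρ : 𝓢(EuclideanSpace ℝ (Fin n), ℂ), HasCompactSupport ρ ∧
    (∀ x, 1 / 4 ≤ ‖x‖ → ρ x = 0) ∧ ∫ x, ρ x = 1 := by
  let b : ContDiffBump (0 : EuclideanSpace ℝ (Fin n)) :=
    ⟨1 / 8, 1 / 4, by norm_num, by norm_num⟩
  have hc : HasCompactSupport fun x => ((b.normed volume x : ℝ) : ℂ) :=
    b.hasCompactSupport_normed.comp_left (g := fun t : ℝ => (t : ℂ)) (by simp)
  have hs : ContDiff ℝ ((⊤ : ℕ∞) : WithTop ℕ∞) fun x => ((b.normed volume x : ℝ) : ℂ) :=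
    Complex.ofRealCLM.contDiff.comp b.contDiff_normed
  refine ⟨hc.toSchwartzMap hs, hc, fun x hx => ?_, ?_⟩
  · have : x ∉ Function.support (b.normed volume) := by
      rw [b.support_normed_eq, mem_ball_zero_iff, not_lt]; exact hx
    simpa using this
  · simp only [HasCompactSupport.toSchwartzMap_toFun]
    change ∫ x, ((b.normed volume x : ℝ) : ℂ) = 1
    rw [integral_complex_ofReal, b.integral_normed, Complex.ofReal_one]

/-- A mollified indicator function at scale `h`. -/
lemma exists_mollified {ρ : 𝓢(EuclideanSpace ℝ (Fin n), ℂ)} (hρ : HasCompactSupport ρ)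
    {h : ℝ} (hh : 0 < h) {A : Set (EuclideanSpace ℝ (Fin n))} (hAm : MeasurableSet A)
    (hAb : Bornology.IsBounded A) : ∃ φ : 𝓢(EuclideanSpace ℝ (Fin n), ℂ),
      (∀ x, φ x = ∫ y in A, ρ (h⁻¹ • x - y)) ∧
      ∀ β x, ‖op (monomial β 1) φ x‖ ≤
        (∫ y, ‖op (monomial β 1) ρ y‖) * (h ^ β.degree)⁻¹ := by
  have hAc : HasCompactSupport (A.indicator fun _ => (1 : ℝ)) :=
    HasCompactSupport.intro hAb.isCompact_closure fun x hx =>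
      Set.indicator_of_notMem (fun h => hx (subset_closure h)) _
  have hcs : HasCompactSupport (convInd A ρ) :=
    hAc.convolution (ContinuousLinearMap.lsmul ℝ ℝ) hρ
  have hsm : ContDiff ℝ ((⊤ : ℕ∞) : WithTop ℕ∞) (convInd A ρ) :=
    hρ.contDiff_convolution_right (n := ⊤) (ContinuousLinearMap.lsmul ℝ ℝ)
      (locallyIntegrable_indicator hAm) (ρ.smooth ⊤)
  obtain ⟨ψ, hψ⟩ : ∃ ψ : 𝓢(EuclideanSpace ℝ (Fin n), ℂ), ⇑ψ = convInd A ρ :=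
    ⟨hcs.toSchwartzMap hsm, funext fun _ => HasCompactSupport.toSchwartzMap_toFun ..⟩
  refine ⟨dilate hh.ne' ψ, fun x => ?_, fun β x => ?_⟩
  · rw [dilate_apply, hψ, convInd_apply hAm]
  · rw [op_monomial_dilate, _root_.smul_apply, norm_smul, Complex.norm_real,
      Real.norm_of_nonneg (by positivity), mul_comm, dilate_apply,
      op_monomial_convInd hAm hρ hψ]
    gcongr
    exact norm_convInd_le hAm _ _

/-- Cutoff functions between two shrinkings of a bounded set, with uniform derivative bounds. -/
lemma exists_cutoff (n : ℕ) : ∃ K : (Fin n →₀ ℕ) → ℝ, (∀ β, 0 ≤ K β) ∧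
    ∀ (ω : Set (EuclideanSpace ℝ (Fin n))), Bornology.IsBounded ω → ∀ s h : ℝ, 0 ≤ s → 0 < h →
    ∃ φ : 𝓢(EuclideanSpace ℝ (Fin n), ℂ), (∀ x ∈ shrink ω (s + h), φ x = 1) ∧
      (∀ β, ∀ x ∉ shrink ω s, op (monomial β 1) φ x = 0) ∧
      ∀ β x, ‖op (monomial β 1) φ x‖ ≤ K β * (h ^ β.degree)⁻¹ := by
  obtain ⟨ρ, hρc, hρ0, hρ1⟩ := exists_bump n
  refine ⟨fun β => ∫ y, ‖op (monomial β 1) ρ y‖, fun β => integral_nonneg fun _ => norm_nonneg _,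
    fun ω hω s h hs hh => ?_⟩
  -- The indicator of the intermediate set `shrink ω (s + h / 2)` is rescaled to unit size and
  -- mollified there by one fixed `ρ`, so the bounds depend neither on `ω` nor on `h`. Undoing the
  -- dilation makes the mollification radius `h/4`, which fits on both sides.
  have hAm : MeasurableSet ((fun z => h • z) ⁻¹' shrink ω (s + h / 2)) :=
    ((isOpen_shrink ω _).preimage (continuous_const_smul h)).measurableSet
  have hAb : Bornology.IsBounded ((fun z => h • z) ⁻¹' shrink ω (s + h / 2)) := by
    rw [Set.preimage_smul₀ hh.ne']
    exact (hω.subset (shrink_subset ω _)).smul₀ _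
  obtain ⟨φ, hval, hbd⟩ := exists_mollified hρc hh hAm hAb
  have hdist : ∀ x y : EuclideanSpace ℝ (Fin n), ρ (h⁻¹ • x - y) ≠ 0 →
      dist x (h • y) < h / 4 := fun x y hy => by
    have h1 : ‖h⁻¹ • x - y‖ < 1 / 4 := by
      by_contra hc
      exact hy (hρ0 _ (not_lt.1 hc))
    have h2 : x - h • y = h • (h⁻¹ • x - y) := by
      rw [smul_sub, smul_smul, mul_inv_cancel₀ hh.ne', one_smul]
    rw [dist_eq_norm, h2, norm_smul, Real.norm_of_nonneg hh.le]
    linarith [mul_lt_mul_of_pos_left h1 hh]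
  refine ⟨φ, fun x hx => ?_, fun β x hx => ?_, hbd⟩
  · rw [hval, setIntegral_eq_integral_of_forall_compl_eq_zero,
      integral_sub_left_eq_self (fun y => ρ y) volume (h⁻¹ • x), hρ1]
    intro y hy
    by_contra hne
    refine hy (mem_shrink_of_dist_lt (r := h / 2) (by positivity) ?_
      ((hdist x y hne).trans (by linarith)))
    rwa [add_assoc, add_halves]
  -- Derivatives must vanish as well, so `φ` is shown to vanish on an open set containing the
  -- complement of `shrink ω s`.
  · have hV : IsOpen {x | Metric.infEDist x ωᶜ < ENNReal.ofReal (s + h / 4)} :=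
      isOpen_lt Metric.continuous_infEDist continuous_const
    have h0 : Set.EqOn φ (0 : 𝓢(EuclideanSpace ℝ (Fin n), ℂ))
        {x | Metric.infEDist x ωᶜ < ENNReal.ofReal (s + h / 4)} := by
      intro z hz
      rw [hval, setIntegral_eq_zero_of_forall_eq_zero]
      · simp
      intro y hy
      by_contra hne
      have h1 := hdist z y hne
      rw [dist_comm] at h1
      have h2 : h • y ∈ shrink ω (s + h / 4 + h / 4) := by
        have : s + h / 4 + h / 4 = s + h / 2 := by ring
        rw [this]; exact hy
      have h3 := mem_shrink_of_dist_lt (by positivity) h2 h1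
      exact absurd h3.2 (not_lt.2 (le_of_lt hz))
    have hx' : Metric.infEDist x ωᶜ < ENNReal.ofReal (s + h / 4) := by
      rw [shrink_eq, Set.mem_ofPred_eq, not_lt] at hx
      exact hx.trans_lt (by rw [ENNReal.ofReal_lt_ofReal_iff (by positivity)]; linarith)
    simpa using op_eqOn hV (monomial β 1) h0 hx'

/-! ### Absorbing the lower order terms -/

/-- Iterating sums a geometric series to `2a`, with a remainder that dies because `g` is bounded as
`h → 0`. -/
lemma le_two_mul_of_half_scale {g : ℝ → ℝ} {h₀ a B : ℝ} (hh₀ : 0 < h₀)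
    (hB : ∀ h, 0 < h → h ≤ h₀ → g h ≤ B)
    (hg : ∀ h, 0 < h → h ≤ h₀ → g h ≤ 1 / 2 * g (h / 2) + a) : g h₀ ≤ 2 * a := by
  have key : ∀ J : ℕ, ∀ h, 0 < h → h ≤ h₀ → g h ≤ 2 * a + (1 / 2) ^ J * (B - 2 * a) := by
    intro J
    induction J with
    | zero => intro h h1 h2; linarith [hB h h1 h2]
    | succ J ih =>
      intro h h1 h2
      have h3 := ih (h / 2) (by positivity) (by linarith)
      have h4 := hg h h1 h2
      rw [pow_succ]
      linarith
  have hlim : Filter.Tendsto (fun J : ℕ => 2 * a + (1 / 2 : ℝ) ^ J * (B - 2 * a)) Filter.atTop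
      (nhds (2 * a)) := by
    have := ((tendsto_pow_atTop_nhds_zero_of_lt_one (r := (1 / 2 : ℝ)) (by norm_num)
      (by norm_num)).mul_const (B - 2 * a)).const_add (2 * a)
    simpa using this
  exact ge_of_tendsto' hlim fun J => key J h₀ hh₀ le_rfl

/-- The lower order terms of `P` applied to `v` over `shrink ω s`, weighted at scale `h`. -/
def lowerSum (P : MvPolynomial (Fin n) ℂ) (ω : Set (EuclideanSpace ℝ (Fin n)))
    (v : 𝓢(EuclideanSpace ℝ (Fin n), ℂ)) (s h : ℝ) : ℝ :=
  ∑ β ∈ (taylor P).support.erase 0, (h ^ β.degree)⁻¹ * nrm (shrink ω s) (op (coeff β (taylor P)) v)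

lemma lowerSum_nonneg (P : MvPolynomial (Fin n) ℂ) (ω : Set (EuclideanSpace ℝ (Fin n)))
    (v : 𝓢(EuclideanSpace ℝ (Fin n), ℂ)) (s : ℝ) {h : ℝ} (hh : 0 ≤ h) :
    0 ≤ lowerSum P ω v s h :=
  Finset.sum_nonneg fun _ _ => mul_nonneg (by positivity) (nrm_nonneg _ _)

/-- Cutting off costs only lower order terms. -/
lemma exists_nrm_op_cutoff_le (P : MvPolynomial (Fin n) ℂ) : ∃ K : ℝ, 0 < K ∧
    ∀ (ω : Set (EuclideanSpace ℝ (Fin n))), Bornology.IsBounded ω → ∀ s h : ℝ, 0 ≤ s → 0 < h →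
    ∀ v : 𝓢(EuclideanSpace ℝ (Fin n), ℂ), ∃ w : 𝓢(EuclideanSpace ℝ (Fin n), ℂ),
      Set.EqOn v w (shrink ω (s + h)) ∧
      nrm Set.univ w ≤ K * nrm (shrink ω s) v ∧
      nrm Set.univ (op P w) ≤ K * (nrm (shrink ω s) (op P v) + lowerSum P ω v s h) := by
  obtain ⟨K, hK, hcut⟩ := exists_cutoff n
  have hKs : 0 ≤ ∑ β ∈ (taylor P).support, K β := Finset.sum_nonneg fun β _ => hK β
  refine ⟨(∑ β ∈ (taylor P).support, K β) + K 0 + 1, by linarith [hK 0],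
    fun ω hω s h hs hh v => ?_⟩
  obtain ⟨φ, h1, h0, hb⟩ := hcut ω hω s h hs hh
  have hms : MeasurableSet (shrink ω s) := (isOpen_shrink ω s).measurableSet
  have hterm : ∀ β w, nrm Set.univ (mulS (op (monomial β 1) φ) w) ≤
      K β * ((h ^ β.degree)⁻¹ * nrm (shrink ω s) w) := fun β w => by
    rw [← mul_assoc]
    exact nrm_mulS_le hms (mul_nonneg (hK β) (by positivity)) (hb β) (h0 β) w
  refine ⟨mulS φ v, fun x hx => ?_, ?_, ?_⟩
  · rw [mulS_apply, h1 x hx, one_mul]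
  · have h2 := hterm 0 v
    rw [monomial_zero_one, op_one, map_zero, pow_zero, inv_one, one_mul] at h2
    refine h2.trans (mul_le_mul_of_nonneg_right ?_ (nrm_nonneg _ _))
    linarith
  · have hL := lowerSum_nonneg P ω v s hh.le
    have hA := nrm_nonneg (shrink ω s) (op P v)
    rw [op_mulS, leibnizSum]
    refine (nrm_sum_le _ _ _).trans ?_
    refine le_trans (Finset.sum_le_sum fun β hβ => ?_) (b := ∑ β ∈ (taylor P).support,
      K β * (nrm (shrink ω s) (op P v) + lowerSum P ω v s h)) ?_
    · refine (hterm β _).trans (mul_le_mul_of_nonneg_left ?_ (hK β))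
      by_cases hβ0 : β = 0
      · subst hβ0
        rw [map_zero, pow_zero, inv_one, one_mul, coeff_taylor_zero]
        linarith
      · refine le_trans ?_ (le_add_of_nonneg_left hA)
        exact Finset.single_le_sum (f := fun β : Fin n →₀ ℕ => (h ^ β.degree)⁻¹ *
          nrm (shrink ω s) (op (coeff β (taylor P)) v))
          (fun _ _ => mul_nonneg (by positivity) (nrm_nonneg _ _))
          (Finset.mem_erase.2 ⟨hβ0, hβ⟩)
    · rw [← Finset.sum_mul]
      refine mul_le_mul_of_nonneg_right ?_ (by linarith)
      linarith [hK 0]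

lemma rpow_neg_mul_self {h : ℝ} (hh : 0 < h) (γ : ℝ) : h ^ γ * h ^ (-γ) = 1 := by
  rw [← Real.rpow_add hh, add_neg_cancel, Real.rpow_zero]

section Estimates

variable {P : MvPolynomial (Fin n) ℂ} {N : ℕ} {d : ℝ}

/-- The cutoff moves the terms to the whole space, where symbol interpolation applies; Leibniz then
brings back the lower order terms on the larger set, with a factor as small as desired. -/
lemma exists_lowerSum_le_step (hN : P.totalDegree ≤ N) (hd : 1 ≤ d)
    (hP : ∀ β, ∃ C : ℝ, 0 < C ∧ ∀ ζ,
      ‖ζ‖ ^ ((β.degree : ℝ) / d) * ‖symbolAt (coeff β (taylor P)) ζ‖ ≤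
        C * (1 + ‖symbolAt P ζ‖)) {R κ : ℝ} (hR : 1 ≤ R) (hκ : 0 < κ) :
    ∃ C : ℝ, 0 < C ∧ ∀ (ω : Set (EuclideanSpace ℝ (Fin n))), Bornology.IsBounded ω →
      ∀ s h : ℝ, 0 ≤ s → 0 < h → h ≤ R → ∀ v : 𝓢(EuclideanSpace ℝ (Fin n), ℂ),
      lowerSum P ω v (s + h) h ≤ κ * (nrm (shrink ω s) (op P v) + lowerSum P ω v s h) +
        C * h ^ (-(d * N)) * nrm (shrink ω s) v := by
  obtain ⟨K, hK, hcut⟩ := exists_nrm_op_cutoff_le P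
  set F := (taylor P).support.erase 0 with hF
  -- Leaves room for the number of terms and for the cutoff constant; the `+ 1` covers an empty `F`.
  set κ' := κ / ((F.card + 1) * K) with hκ'
  have hκ'0 : 0 < κ' := by positivity
  have hint : ∀ β ∈ F, ∃ C : ℝ, 0 < C ∧ ∀ h : ℝ, 0 < h → h ≤ R → ∀ ζ,
      (h ^ β.degree)⁻¹ * ‖symbolAt (coeff β (taylor P)) ζ‖ ≤
        κ' * ‖symbolAt P ζ‖ + C * h ^ (-(d * N)) := fun β hβ =>
    exists_interpolation_le hN hd (Finset.ne_of_mem_erase hβ) (hP β) hκ'0 hR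
  choose! C hC hint using hint
  have hCs : 0 ≤ ∑ β ∈ F, C β := Finset.sum_nonneg fun β hβ => (hC β hβ).le
  refine ⟨(∑ β ∈ F, C β) * K + 1, by positivity, fun ω hω s h hs hh hhR v => ?_⟩
  obtain ⟨w, hvw, hw, hPw⟩ := hcut ω hω s h hs hh v
  have hB := nrm_nonneg (shrink ω s) v
  have hA := nrm_nonneg (shrink ω s) (op P v)
  have hL := lowerSum_nonneg P ω v s hh.le
  have hhγ : 0 < h ^ (-(d * N)) := Real.rpow_pos_of_pos hh _
  have hβ : ∀ β ∈ F, (h ^ β.degree)⁻¹ *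
      nrm (shrink ω (s + h)) (op (coeff β (taylor P)) v) ≤
      κ' * (K * (nrm (shrink ω s) (op P v) + lowerSum P ω v s h)) +
        C β * h ^ (-(d * N)) * (K * nrm (shrink ω s) v) := by
    intro β hβ
    have hCβ := hC β hβ
    have h1 : nrm (shrink ω (s + h)) (op (coeff β (taylor P)) v) ≤
        nrm Set.univ (op (coeff β (taylor P)) w) :=
      nrm_le_of_eqOn (isOpen_shrink _ _).measurableSet (op_eqOn (isOpen_shrink _ _) _ hvw)
    refine (mul_le_mul_of_nonneg_left h1 (by positivity)).trans ?_
    refine (nrm_op_le_of_symbol (by positivity) hκ'0.le (by positivity)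
      (hint β hβ h hh hhR) w).trans ?_
    gcongr
  refine (Finset.sum_le_sum hβ).trans ?_
  rw [Finset.sum_add_distrib, Finset.sum_const, nsmul_eq_mul, ← Finset.sum_mul, ← Finset.sum_mul]
  refine add_le_add ?_ ?_
  · rw [← mul_assoc, ← mul_assoc]
    refine mul_le_mul_of_nonneg_right ?_ (by positivity)
    have : (F.card + 1) * κ' * K = κ := by rw [hκ']; field_simp
    have : 0 < κ' * K := by positivity
    nlinarith
  · have : 0 ≤ h ^ (-(d * N)) * nrm (shrink ω s) v := by positivity
    nlinarith

lemma exists_lowerSum_le (hN : P.totalDegree ≤ N) (hd : 1 ≤ d)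
    (hP : ∀ β, ∃ C : ℝ, 0 < C ∧ ∀ ζ,
      ‖ζ‖ ^ ((β.degree : ℝ) / d) * ‖symbolAt (coeff β (taylor P)) ζ‖ ≤
        C * (1 + ‖symbolAt P ζ‖)) {R : ℝ} (hR : 1 ≤ R) :
    ∃ C : ℝ, 0 < C ∧ ∀ (ω : Set (EuclideanSpace ℝ (Fin n))), Bornology.IsBounded ω →
      ∀ s h : ℝ, 0 ≤ s → 0 < h → h ≤ R → ∀ v : 𝓢(EuclideanSpace ℝ (Fin n), ℂ),
      lowerSum P ω v (s + 2 * h) h ≤ C * (nrm (shrink ω s) (op P v) +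
        h ^ (-(d * N)) * nrm (shrink ω s) v) := by
  set γ : ℝ := d * N with hγ
  have hγ0 : 0 ≤ γ := by positivity
  -- The factor `2^{-γ}` pays for the change of weight from `h^γ` to `(h/2)^γ`, leaving the
  -- contraction factor `1/2`.
  set κ : ℝ := 1 / 2 * 2 ^ (-γ) with hκ
  have hκ0 : 0 < κ := by positivity
  have hκ1 : κ ≤ 1 := by
    have : (2 : ℝ) ^ (-γ) ≤ 1 := Real.rpow_le_one_of_one_le_of_nonpos (by norm_num) (by linarith)
    linarith
  obtain ⟨C, hC, hstep⟩ := exists_lowerSum_le_step hN hd hP hR hκ0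
  refine ⟨2 * (1 + C), by positivity, fun ω hω s h₀ hs hh₀ hh₀R v => ?_⟩
  set A := nrm (shrink ω s) (op P v) with hAdef
  set B := nrm (shrink ω s) v with hBdef
  have hA0 : 0 ≤ A := nrm_nonneg _ _
  have hB0 : 0 ≤ B := nrm_nonneg _ _
  have key : h₀ ^ γ * lowerSum P ω v (s + 2 * h₀) h₀ ≤ 2 * (h₀ ^ γ * A + C * B) := by
    -- The weight `h^γ` keeps the quantity bounded as `h → 0`, because every `|β|` that occurs is at
    -- most `N ≤ γ`.
    refine le_two_mul_of_half_scale (g := fun h => h ^ γ * lowerSum P ω v (s + 2 * h) h) hh₀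
      (B := ∑ β ∈ (taylor P).support.erase 0, h₀ ^ (γ - β.degree) *
        nrm Set.univ (op (coeff β (taylor P)) v)) (fun h hh hhh₀ => ?_) (fun h hh hhh₀ => ?_)
    · rw [lowerSum, Finset.mul_sum]
      refine Finset.sum_le_sum fun β hβ => ?_
      have hβN : (β.degree : ℝ) ≤ γ := by
        have h1 : β.degree ≤ N := by
          by_contra hlt
          exact mem_support_iff.1 (Finset.mem_of_mem_erase hβ)
            (coeff_taylor_eq_zero hN (not_le.1 hlt))
        calc (β.degree : ℝ) ≤ N := by exact_mod_cast h1
          _ ≤ γ := le_mul_of_one_le_left (by positivity) hd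
      rw [← mul_assoc, ← Real.rpow_natCast h, ← div_eq_mul_inv, ← Real.rpow_sub hh]
      refine mul_le_mul (Real.rpow_le_rpow hh.le hhh₀ (by linarith))
        (nrm_mono (Set.subset_univ _) _) (nrm_nonneg _ _) (by positivity)
    · have h1 := hstep ω hω (s + h) h (by positivity) hh (hhh₀.trans hh₀R) v
      have e1 : s + h + h = s + 2 * h := by ring
      rw [e1] at h1
      have h2 : nrm (shrink ω (s + h)) (op P v) ≤ A := nrm_mono (shrink_anti ω (by linarith)) _
      have h3 : nrm (shrink ω (s + h)) v ≤ B := nrm_mono (shrink_anti ω (by linarith)) _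
      -- The set shrunk by `s + h` is the one belonging to scale `h/2`, and halving the scale only
      -- increases the weights.
      have h4 : lowerSum P ω v (s + h) h ≤ lowerSum P ω v (s + 2 * (h / 2)) (h / 2) := by
        rw [mul_div_cancel₀ h two_ne_zero]
        refine Finset.sum_le_sum fun β _ => mul_le_mul_of_nonneg_right ?_ (nrm_nonneg _ _)
        gcongr
        linarith
      have h5 : h ^ γ * κ = 1 / 2 * (h / 2) ^ γ := by
        rw [hκ, Real.div_rpow hh.le (by norm_num), Real.rpow_neg (by norm_num)]
        field_simp
      have h6 := rpow_neg_mul_self hh γ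
      have h7 : h ^ γ ≤ h₀ ^ γ := Real.rpow_le_rpow hh.le hhh₀ hγ0
      have h8 : 0 < h ^ γ := Real.rpow_pos_of_pos hh _
      have h9 : 0 < h ^ (-γ) := Real.rpow_pos_of_pos hh _
      calc h ^ γ * lowerSum P ω v (s + 2 * h) h
          ≤ h ^ γ * (κ * (A + lowerSum P ω v (s + 2 * (h / 2)) (h / 2)) +
              C * h ^ (-γ) * B) := by
            refine mul_le_mul_of_nonneg_left (h1.trans ?_) h8.le
            gcongr
        _ = κ * (h ^ γ * A) + (h ^ γ * κ) * lowerSum P ω v (s + 2 * (h / 2)) (h / 2) +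
              C * (h ^ γ * h ^ (-γ)) * B := by ring
        _ ≤ h₀ ^ γ * A + (h ^ γ * κ) * lowerSum P ω v (s + 2 * (h / 2)) (h / 2) +
              C * (h ^ γ * h ^ (-γ)) * B := by
            have h10 : κ * (h ^ γ * A) ≤ h ^ γ * A := mul_le_of_le_one_left (by positivity) hκ1
            have h11 : h ^ γ * A ≤ h₀ ^ γ * A := mul_le_mul_of_nonneg_right h7 hA0
            linarith
        _ = _ := by rw [h5, h6]; ring
  have h8 : 0 < h₀ ^ (-γ) := Real.rpow_pos_of_pos hh₀ _
  have h6 := rpow_neg_mul_self hh₀ γ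
  calc lowerSum P ω v (s + 2 * h₀) h₀
      = h₀ ^ (-γ) * (h₀ ^ γ * lowerSum P ω v (s + 2 * h₀) h₀) := by
        rw [← mul_assoc, mul_comm (h₀ ^ (-γ)), h6, one_mul]
    _ ≤ h₀ ^ (-γ) * (2 * (h₀ ^ γ * A + C * B)) := by gcongr
    _ = 2 * (h₀ ^ γ * h₀ ^ (-γ)) * A + 2 * C * (h₀ ^ (-γ) * B) := by ring
    _ ≤ _ := by
        rw [h6]
        have : 0 ≤ h₀ ^ (-γ) * B := by positivity
        nlinarith

/-- The interior estimate with a loss `h ^ (-dN)` in the zeroth order term. -/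
lemma exists_interior_estimate (hN : P.totalDegree ≤ N) (hd : 1 ≤ d)
    (hP : ∀ β, ∃ C : ℝ, 0 < C ∧ ∀ ζ,
      ‖ζ‖ ^ ((β.degree : ℝ) / d) * ‖symbolAt (coeff β (taylor P)) ζ‖ ≤
        C * (1 + ‖symbolAt P ζ‖)) {M : ℕ}
    (hM : ∃ C : ℝ, 0 < C ∧ ∀ ζ : EuclideanSpace ℝ (Fin n),
      (1 + ‖ζ‖) ^ M ≤ C * (1 + ‖symbolAt P ζ‖)) {R : ℝ} (hR : 1 ≤ R) :
    ∃ C : ℝ, 1 ≤ C ∧ ∀ (ω : Set (EuclideanSpace ℝ (Fin n))), Bornology.IsBounded ω →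
      ∀ s h : ℝ, 0 ≤ s → 0 < h → h ≤ R → ∀ α : Fin n →₀ ℕ, α.degree ≤ M →
      ∀ v : 𝓢(EuclideanSpace ℝ (Fin n), ℂ),
      nrm (shrink ω (s + h)) (op (monomial α 1) v) ≤ C * (nrm (shrink ω s) (op P v) +
        h ^ (-(d * N)) * nrm (shrink ω s) v) := by
  set γ : ℝ := d * N with hγ
  have hγ0 : 0 ≤ γ := by positivity
  obtain ⟨C₁, hC₁, hM⟩ := hM
  obtain ⟨K, hK, hcut⟩ := exists_nrm_op_cutoff_le P
  obtain ⟨C₂, hC₂, hlow⟩ := exists_lowerSum_le hN hd hP hR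
  refine ⟨1 + C₁ * K * (1 + C₂ * 3 ^ γ + R ^ γ), le_add_of_nonneg_right (by positivity),
    fun ω hω s h hs hh hhR α hα v => ?_⟩
  -- Two thirds of the margin control the lower order terms; the last third carries the cutoff.
  obtain ⟨w, hvw, hw, hPw⟩ := hcut ω hω (s + 2 * (h / 3)) (h / 3) (by positivity) (by positivity) v
  have e : s + 2 * (h / 3) + h / 3 = s + h := by ring
  rw [e] at hvw
  set A := nrm (shrink ω s) (op P v) with hAdef
  set B := nrm (shrink ω s) v with hBdef
  have hA0 : 0 ≤ A := nrm_nonneg _ _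
  have hB0 : 0 ≤ B := nrm_nonneg _ _
  have hlow' := hlow ω hω s (h / 3) hs (by positivity) (by linarith) v
  have e2 : (h / 3) ^ (-γ) = 3 ^ γ * h ^ (-γ) := by
    rw [Real.div_rpow hh.le (by norm_num), Real.rpow_neg (by norm_num : (0 : ℝ) ≤ 3)]
    field_simp
  rw [e2] at hlow'
  have hA' : nrm (shrink ω (s + 2 * (h / 3))) (op P v) ≤ A :=
    nrm_mono (shrink_anti ω (by linarith)) _
  have hB' : nrm (shrink ω (s + 2 * (h / 3))) v ≤ B := nrm_mono (shrink_anti ω (by linarith)) _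
  have hsym : ∀ ζ : EuclideanSpace ℝ (Fin n),
      1 * ‖symbolAt (monomial α 1) ζ‖ ≤ C₁ * ‖symbolAt P ζ‖ + C₁ := fun ζ => by
    have h1 : (1 : ℝ) ≤ 1 + ‖ζ‖ := by linarith [norm_nonneg ζ]
    have := ((norm_symbolAt_monomial_le α ζ).trans (pow_le_pow_right₀ h1 hα)).trans (hM ζ)
    linarith
  have h1 : nrm (shrink ω (s + h)) (op (monomial α 1) v) ≤
      C₁ * nrm Set.univ (op P w) + C₁ * nrm Set.univ w := by
    have := nrm_op_le_of_symbol zero_le_one hC₁.le hC₁.le hsym w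
    rw [one_mul] at this
    exact (nrm_le_of_eqOn (isOpen_shrink _ _).measurableSet
      (op_eqOn (isOpen_shrink _ _) _ hvw)).trans this
  set H := h ^ (-γ) with hH
  have hH0 : 0 < H := Real.rpow_pos_of_pos hh _
  have hRH : 1 ≤ R ^ γ * H := by
    rw [hH, Real.rpow_neg hh.le, ← div_eq_mul_inv, ← Real.div_rpow (by linarith) hh.le]
    exact Real.one_le_rpow ((one_le_div hh).2 hhR) hγ0
  have h3 : (1 : ℝ) ≤ 3 ^ γ := Real.one_le_rpow (by norm_num) hγ0
  have hR0 : 0 < R ^ γ := Real.rpow_pos_of_pos (by linarith) _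
  calc _ ≤ C₁ * (K * (A + C₂ * (A + 3 ^ γ * H * B))) + C₁ * (K * (R ^ γ * H * B)) := by
        refine h1.trans ?_
        have hw' : nrm Set.univ w ≤ K * (R ^ γ * H * B) := by
          refine hw.trans (mul_le_mul_of_nonneg_left ?_ hK.le)
          exact hB'.trans (le_mul_of_one_le_left hB0 hRH)
        have hPw' : nrm Set.univ (op P w) ≤ K * (A + C₂ * (A + 3 ^ γ * H * B)) :=
          hPw.trans (mul_le_mul_of_nonneg_left (add_le_add hA' hlow') hK.le)
        gcongr
    _ = C₁ * K * ((1 + C₂) * A + (C₂ * 3 ^ γ + R ^ γ) * (H * B)) := by ring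
    _ ≤ C₁ * K * ((1 + C₂ * 3 ^ γ + R ^ γ) * A + (1 + C₂ * 3 ^ γ + R ^ γ) * (H * B)) := by
        have : 0 ≤ H * B := by positivity
        refine mul_le_mul_of_nonneg_left (add_le_add ?_ ?_) (by positivity)
        · refine mul_le_mul_of_nonneg_right ?_ hA0
          nlinarith
        · refine mul_le_mul_of_nonneg_right ?_ this
          linarith
    _ = C₁ * K * (1 + C₂ * 3 ^ γ + R ^ γ) * (A + H * B) := by ring
    _ ≤ _ := by
        refine mul_le_mul_of_nonneg_right ?_ (by positivity)
        linarith

end Estimates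

/-! ### Iteration of the interior estimate -/

lemma sum_choose_succ_mul (H : ℝ) (a : ℕ → ℝ) (k : ℕ) :
    ∑ i ∈ Finset.range (k + 2), ((k + 1).choose i : ℝ) * H ^ (k + 1 - i) * a i =
      ∑ i ∈ Finset.range (k + 1), (k.choose i : ℝ) * H ^ (k - i) * a (i + 1) +
      H * ∑ i ∈ Finset.range (k + 1), (k.choose i : ℝ) * H ^ (k - i) * a i := by
  have h1 : H * ∑ i ∈ Finset.range (k + 1), (k.choose i : ℝ) * H ^ (k - i) * a i =
      ∑ i ∈ Finset.range (k + 2), (k.choose i : ℝ) * H ^ (k + 1 - i) * a i := by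
    rw [Finset.sum_range_succ _ (k + 1), Nat.choose_succ_self, Nat.cast_zero, zero_mul, zero_mul,
      add_zero, Finset.mul_sum]
    refine Finset.sum_congr rfl fun i hi => ?_
    have : k + 1 - i = k - i + 1 := by have := Finset.mem_range.1 hi; omega
    rw [this, pow_succ]; ring
  rw [h1, Finset.sum_range_succ', Finset.sum_range_succ' _ (k + 1), ← add_assoc,
    ← Finset.sum_add_distrib]
  congr 1
  · refine Finset.sum_congr rfl fun i _ => ?_
    rw [Nat.choose_succ_succ, Nat.add_sub_add_right]
    push_cast; ring
  · simp

/-- Iteration of an interior estimate. -/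
lemma nrm_op_monomial_le_of_step {P : MvPolynomial (Fin n) ℂ}
    {ω : Set (EuclideanSpace ℝ (Fin n))} {M : ℕ} {C h H : ℝ} (hC : 0 ≤ C) (hh : 0 ≤ h) (hH : 0 ≤ H)
    (hstep : ∀ s : ℝ, 0 ≤ s → ∀ α : Fin n →₀ ℕ, α.degree ≤ M →
      ∀ v : 𝓢(EuclideanSpace ℝ (Fin n), ℂ),
      nrm (shrink ω (s + h)) (op (monomial α 1) v) ≤
        C * (nrm (shrink ω s) (op P v) + H * nrm (shrink ω s) v))
    {s : ℝ} (hs : 0 ≤ s) (k : ℕ) (α : Fin n →₀ ℕ) (hα : α.degree ≤ k * M)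
    (v : 𝓢(EuclideanSpace ℝ (Fin n), ℂ)) :
    nrm (shrink ω (s + k * h)) (op (monomial α 1) v) ≤
      C ^ k * ∑ i ∈ Finset.range (k + 1),
        (k.choose i : ℝ) * H ^ (k - i) * nrm (shrink ω s) (op (P ^ i) v) := by
  induction k generalizing α v with
  | zero =>
    have : α = 0 := by
      rw [← Finsupp.degree_eq_zero_iff]; omega
    subst this
    simp [monomial_zero_one, op_one]
  | succ k ih =>
    -- Up to `M` derivatives are peeled off for the outermost step, which is applied to `D^θ v`; the
    -- induction hypothesis then handles `D^θ` on both `P v` and `v`.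
    obtain ⟨β, θ, rfl, hβ, hθ⟩ : ∃ β θ : Fin n →₀ ℕ, α = β + θ ∧ β.degree ≤ M ∧
        θ.degree ≤ k * M := by
      obtain ⟨β, hle, hdeg⟩ := Finsupp.exists_le_degree_eq α (min M α.degree) (min_le_right _ _)
      refine ⟨β, α - β, (add_tsub_cancel_of_le hle).symm, ?_, ?_⟩
      · rw [hdeg]; exact min_le_left _ _
      · have := congrArg Finsupp.degree (add_tsub_cancel_of_le hle)
        rw [map_add, hdeg] at this
        rw [add_mul, one_mul] at hα
        omega
    have hmon : (monomial (β + θ) 1 : MvPolynomial (Fin n) ℂ) = monomial β 1 * monomial θ 1 := by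
      rw [monomial_mul, one_mul]
    have e : s + ((k + 1 : ℕ) : ℝ) * h = s + k * h + h := by push_cast; ring
    rw [hmon, op_mul, e]
    refine (hstep (s + k * h) (by positivity) β hβ _).trans ?_
    rw [op_comm P]
    have h1 := ih θ hθ (op P v)
    have h2 := ih θ hθ v
    rw [pow_succ, sum_choose_succ_mul H (fun i => nrm (shrink ω s) (op (P ^ i) v)),
      mul_comm (C ^ k), mul_assoc]
    refine mul_le_mul_of_nonneg_left ?_ hC
    rw [mul_add, mul_left_comm]
    refine add_le_add ?_ (mul_le_mul_of_nonneg_left h2 hH)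
    simpa only [pow_succ, op_mul] using h1

/-! ### From Schwartz functions to functions smooth on `ω` -/

/-- A smooth function on a bounded open set agrees on each shrinking with a Schwartz function. -/
lemma exists_schwartz_eqOn_shrink {ω : Set (EuclideanSpace ℝ (Fin n))} (hω : IsOpen ω)
    (hωb : Bornology.IsBounded ω) {u : EuclideanSpace ℝ (Fin n) → ℂ}
    (hu : ContDiffOn ℝ ((⊤ : ℕ∞) : WithTop ℕ∞) u ω) {s : ℝ} (hs : 0 < s) :
    ∃ v : 𝓢(EuclideanSpace ℝ (Fin n), ℂ), Set.EqOn v u (shrink ω s) := by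
  obtain ⟨K, _, hcut⟩ := exists_cutoff n
  obtain ⟨φ, h1, h0, _⟩ := hcut ω hωb (s / 2) (s / 2) (by positivity) (by positivity)
  have h0' : ∀ x ∉ shrink ω (s / 2), φ x = 0 := fun x hx => by
    simpa [monomial_zero_one, op_one] using h0 0 x hx
  have hsupp : tsupport (fun x => φ x * u x) ⊆ closure (shrink ω (s / 2)) := by
    refine closure_mono fun x hx => ?_
    by_contra hc
    exact hx (by simp [h0' x hc])
  -- The cutoff product is supported in a compact subset of `ω`, so its values outside `ω` are zero
  -- and it is smooth everywhere.
  have hclos : closure (shrink ω (s / 2)) ⊆ ω := by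
    have hcl : IsClosed {x | ENNReal.ofReal (s / 2) ≤ Metric.infEDist x ωᶜ} :=
      isClosed_le continuous_const Metric.continuous_infEDist
    refine (closure_minimal (fun x hx => le_of_lt hx.2) hcl).trans fun x hx => ?_
    by_contra hxω
    have h2 : Metric.infEDist x ωᶜ = 0 := Metric.infEDist_zero_of_mem hxω
    have h3 : ENNReal.ofReal (s / 2) ≤ Metric.infEDist x ωᶜ := hx
    rw [h2, nonpos_iff_eq_zero, ENNReal.ofReal_eq_zero] at h3
    linarith
  have hc : HasCompactSupport fun x => φ x * u x :=
    (hωb.subset (shrink_subset ω _)).isCompact_closure.of_isClosed_subset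
      (isClosed_tsupport _) hsupp
  have hsm : ContDiff ℝ ((⊤ : ℕ∞) : WithTop ℕ∞) fun x => φ x * u x :=
    contDiff_iff_contDiffAt.2 fun x => by
      by_cases hx : x ∈ tsupport fun x => φ x * u x
      · exact (φ.smooth ⊤).contDiffAt.mul (hu.contDiffAt (hω.mem_nhds (hclos (hsupp hx))))
      · exact contDiffAt_const.congr_of_eventuallyEq (notMem_tsupport_iff_eventuallyEq.1 hx)
  refine ⟨hc.toSchwartzMap hsm, fun x hx => ?_⟩
  rw [HasCompactSupport.toSchwartzMap_toFun, h1 x (by rwa [add_halves]), one_mul]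

/-- On a nonempty shrinking of a bounded set, the shrinking parameter is bounded. -/
lemma exists_le_of_shrink_nonempty (hn : 0 < n) {ω : Set (EuclideanSpace ℝ (Fin n))}
    (hωb : Bornology.IsBounded ω) :
    ∃ R : ℝ, 1 ≤ R ∧ ∀ δ : ℝ, (shrink ω δ).Nonempty → δ ≤ R := by
  obtain ⟨r, hr0, hr⟩ := hωb.subset_ball_lt 0 0
  refine ⟨max 1 (2 * r), le_max_left _ _, fun δ ⟨x, hx, hδ⟩ => le_trans ?_ (le_max_right _ _)⟩
  -- A point outside `ω` at bounded distance; choosing it requires `n > 0`.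
  set y : EuclideanSpace ℝ (Fin n) := EuclideanSpace.single ⟨0, hn⟩ r with hy
  have hyn : ‖y‖ = r := by rw [hy, PiLp.norm_single, Real.norm_of_nonneg hr0.le]
  have hyω : y ∈ ωᶜ := fun h => by
    have := hr h
    rw [mem_ball_zero_iff, hyn] at this
    exact lt_irrefl _ this
  have h1 := hδ.trans_le (Metric.infEDist_le_edist_of_mem hyω)
  rw [edist_dist] at h1
  have h2 : δ < dist x y := (ENNReal.ofReal_lt_ofReal_iff'.1 h1).1
  · have h3 : ‖x‖ < r := mem_ball_zero_iff.1 (hr hx)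
    have h4 := dist_le_norm_add_norm x y
    linarith

/-- The interior estimate for iterates, for functions which are smooth on `ω`. -/
lemma exists_iterated_estimate {ω : Set (EuclideanSpace ℝ (Fin n))} (hω : IsOpen ω)
    (hωb : Bornology.IsBounded ω) {Q : MvPolynomial (Fin n) ℂ} {μ ν : ℕ} (hμ : 0 < μ) (hν : 0 < ν)
    (hQ : IsDHypoelliptic Q ((μ : ℝ) / ν)) (hQd : 0 < Q.totalDegree) :
    ∃ C : ℝ, 0 < C ∧ ∀ k : ℕ, 0 < k → ∀ α : Fin n →₀ ℕ, α.degree ≤ k * (Q.totalDegree * ν) →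
      ∀ δ : ℝ, 0 < δ → ∀ u : EuclideanSpace ℝ (Fin n) → ℂ,
      ContDiffOn ℝ ((⊤ : ℕ∞) : WithTop ℕ∞) u ω →
        l2Norm (shrink ω δ) (multiD α u) ≤
          ENNReal.ofReal (C ^ k) * ∑ i ∈ Finset.range (k + 1),
            ENNReal.ofReal ((k.choose i : ℝ) * ((k : ℝ) / δ) ^
              (((k : ℝ) - i) * ((μ : ℝ) / ν * (Q.totalDegree * μ : ℕ)))) *
            l2Norm ω ((diffOp Q)^[μ * i] u) := by
  have hn : 0 < n := by
    rcases Nat.eq_zero_or_pos n with rfl | hn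
    · rw [eq_C_of_isEmpty Q, totalDegree_C] at hQd
      exact absurd hQd (lt_irrefl _)
    · exact hn
  obtain ⟨hQ0, ⟨hd, hQe⟩, -⟩ := hQ
  set d : ℝ := (μ : ℝ) / ν with hd_def
  have hd0 : 0 < d := by linarith
  obtain ⟨R, hR, hRδ⟩ := exists_le_of_shrink_nonempty hn hωb
  have hN : (Q ^ μ).totalDegree ≤ Q.totalDegree * μ := by
    rw [mul_comm]; exact totalDegree_pow Q μ
  obtain ⟨C, hC, hest⟩ := exists_interior_estimate hN hd
    (hQe.exists_norm_coeff_taylor_pow_le' hd0 μ) (hQe.exists_pow_le hμ hν hQ0) hR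
  set γ : ℝ := d * (Q.totalDegree * μ : ℕ) with hγ
  have hγ0 : 0 ≤ γ := by positivity
  have h2γ : (1 : ℝ) ≤ 2 ^ γ := Real.one_le_rpow (by norm_num) hγ0
  refine ⟨C * 2 ^ γ, by positivity, fun k hk α hα δ hδ u hu => ?_⟩
  rcases (shrink ω δ).eq_empty_or_nonempty with hempty | hne
  · simp [hempty, l2Norm]
  have hδR := hRδ δ hne
  have hk0 : (0 : ℝ) < k := by exact_mod_cast hk
  have hk1 : (1 : ℝ) ≤ k := by exact_mod_cast hk
  obtain ⟨v, hv⟩ := exists_schwartz_eqOn_shrink hω hωb hu (half_pos hδ)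
  -- Half of `δ` pays for replacing `u` by a Schwartz function; the other half is divided among the
  -- `k` steps.
  set h : ℝ := δ / (2 * k) with hh_def
  have hh : 0 < h := by positivity
  have hhR : h ≤ R := by
    refine le_trans ?_ hδR
    rw [hh_def, div_le_iff₀ (by positivity)]
    nlinarith
  have e : δ / 2 + k * h = δ := by rw [hh_def]; field_simp; ring
  have hmain := nrm_op_monomial_le_of_step (zero_le_one.trans hC) hh.le
    (Real.rpow_nonneg hh.le (-γ))
    (fun s hs α hα v => hest ω hωb s h hs hh hhR α hα v) (half_pos hδ).le k α hα v
  rw [e] at hmain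
  have hH : h ^ (-γ) = 2 ^ γ * ((k : ℝ) / δ) ^ γ := by
    rw [← Real.mul_rpow (by norm_num) (by positivity), Real.rpow_neg hh.le,
      ← Real.inv_rpow hh.le]
    congr 1
    rw [hh_def]; field_simp
  have hterm : ∀ i ∈ Finset.range (k + 1), (k.choose i : ℝ) * (h ^ (-γ)) ^ (k - i) *
      nrm (shrink ω (δ / 2)) (op ((Q ^ μ) ^ i) v) ≤ (2 ^ γ) ^ k *
      ((k.choose i : ℝ) * ((k : ℝ) / δ) ^ (((k : ℝ) - i) * γ) *
        nrm (shrink ω (δ / 2)) (op ((Q ^ μ) ^ i) v)) := fun i hi => by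
    have hik : i ≤ k := Nat.lt_succ_iff.1 (Finset.mem_range.1 hi)
    have h1 : (((k : ℝ) / δ) ^ γ) ^ (k - i) = ((k : ℝ) / δ) ^ (((k : ℝ) - i) * γ) := by
      rw [← Real.rpow_natCast, ← Real.rpow_mul (by positivity), Nat.cast_sub hik, mul_comm]
    rw [hH, mul_pow, h1]
    -- The factor 2 lost in `h = δ/(2k)` costs at most `(2^γ)^k`, which goes into `C^k`.
    have h2 : ((2 : ℝ) ^ γ) ^ (k - i) ≤ (2 ^ γ) ^ k := pow_le_pow_right₀ h2γ (Nat.sub_le _ _)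
    have h3 := nrm_nonneg (shrink ω (δ / 2)) (op ((Q ^ μ) ^ i) v)
    calc _ = ((2 : ℝ) ^ γ) ^ (k - i) * ((k.choose i : ℝ) * ((k : ℝ) / δ) ^ (((k : ℝ) - i) * γ) *
        nrm (shrink ω (δ / 2)) (op ((Q ^ μ) ^ i) v)) := by ring
      _ ≤ _ := mul_le_mul_of_nonneg_right h2 (by positivity)
  have hreal : nrm (shrink ω δ) (op (monomial α 1) v) ≤ (C * 2 ^ γ) ^ k *
      ∑ i ∈ Finset.range (k + 1), (k.choose i : ℝ) * ((k : ℝ) / δ) ^ (((k : ℝ) - i) * γ) *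
        nrm (shrink ω (δ / 2)) (op ((Q ^ μ) ^ i) v) := by
    refine hmain.trans ?_
    rw [mul_pow, mul_assoc, Finset.mul_sum (a := ((2 : ℝ) ^ γ) ^ k)]
    exact mul_le_mul_of_nonneg_left (Finset.sum_le_sum hterm) (by positivity)
  have hsub : shrink ω δ ⊆ shrink ω (δ / 2) := shrink_anti ω (by linarith)
  have hl : l2Norm (shrink ω δ) (multiD α u) =
      ENNReal.ofReal (nrm (shrink ω δ) (op (monomial α 1) v)) := by
    rw [ofReal_nrm, coe_op_monomial]
    refine l2Norm_congr (isOpen_shrink _ _).measurableSet ?_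
    exact (multiD_eqOn (isOpen_shrink _ _) α (hv.symm.mono hsub))
  rw [hl]
  refine (ENNReal.ofReal_le_ofReal hreal).trans ?_
  rw [ENNReal.ofReal_mul (by positivity), ENNReal.ofReal_sum_of_nonneg fun i _ =>
    mul_nonneg (by positivity) (nrm_nonneg _ _)]
  gcongr with i hi
  rw [ENNReal.ofReal_mul (by positivity), ofReal_nrm, ← pow_mul, coe_op_pow]
  gcongr
  rw [l2Norm_congr (isOpen_shrink _ _).measurableSet
    (diffOp_iterate_eqOn (isOpen_shrink _ _) Q (μ * i) hv)]
  exact l2Norm_mono (shrink_subset _ _) _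

lemma multiD_zero (u : EuclideanSpace ℝ (Fin n) → ℂ) : multiD 0 u = u := by
  rw [multiD]
  induction List.finRange n with
  | nil => rfl
  | cons j l ih => simp

end IteratedInterior

end

theorem proposition3p1 {n : ℕ} (ω : Set (EuclideanSpace ℝ (Fin n))) (hω : IsOpen ω)
    (hωb : Bornology.IsBounded ω) (Q : MvPolynomial (Fin n) ℂ) (m μ ν : ℕ)
    (hm : Q.totalDegree = m) (hμ : 0 < μ) (hν : 0 < ν)
    (hQ : IteratedInterior.IsDHypoelliptic Q ((μ : ℝ) / (ν : ℝ))) :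
    ∃ C : ℝ, 0 < C ∧
      ∀ (k : ℕ) (α : Fin n →₀ ℕ), α.degree ≤ k * m * ν →
      ∀ δ : ℝ, 0 < δ →
      ∀ u : EuclideanSpace ℝ (Fin n) → ℂ, ContDiffOn ℝ ((⊤ : ℕ∞) : WithTop ℕ∞) u ω →
        IteratedInterior.l2Norm (IteratedInterior.shrink ω δ) (IteratedInterior.multiD α u) ≤
          ENNReal.ofReal (C ^ k) * ∑ i ∈ Finset.range (k + 1),
            ENNReal.ofReal ((k.choose i : ℝ) *
              ((k : ℝ) / δ) ^ (((k : ℝ) - (i : ℝ)) * (((μ : ℝ) / (ν : ℝ)) * (m : ℝ) * (μ : ℝ)))) *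
            IteratedInterior.l2Norm ω ((IteratedInterior.diffOp Q)^[μ * i] u) := by
  subst hm
  -- Degree zero, which includes `n = 0`, forces `α = 0`; the exponent `γ` vanishes and the term `i
  -- = 0` alone suffices.
  rcases Nat.eq_zero_or_pos Q.totalDegree with hQd | hQd
  · refine ⟨1, one_pos, fun k α hα δ hδ u hu => ?_⟩
    obtain rfl : α = 0 := by
      rw [← Finsupp.degree_eq_zero_iff]; simpa [hQd] using hα
    rw [IteratedInterior.multiD_zero, one_pow, ENNReal.ofReal_one, one_mul]
    refine (IteratedInterior.l2Norm_mono (IteratedInterior.shrink_subset ω δ) u).trans ?_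
    refine le_trans (le_of_eq ?_) (Finset.single_le_sum (fun _ _ => zero_le)
      (Finset.mem_range.2 (Nat.succ_pos k)))
    simp [hQd]
  · obtain ⟨C, hC, h⟩ := IteratedInterior.exists_iterated_estimate hω hωb hμ hν hQ hQd
    refine ⟨C, hC, fun k α hα δ hδ u hu => ?_⟩
    -- For `k = 0` the step `δ/(2k)` is meaningless, but `α = 0` and the convention `0 ^ 0 = 1` make
    -- the sum equal to the norm of `u`.
    rcases Nat.eq_zero_or_pos k with rfl | hk
    · obtain rfl : α = 0 := by
        rw [← Finsupp.degree_eq_zero_iff]; simpa using hα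
      rw [IteratedInterior.multiD_zero]
      refine (IteratedInterior.l2Norm_mono (IteratedInterior.shrink_subset ω δ) u).trans ?_
      simp
    · have := h k hk α (by rwa [← mul_assoc]) δ hδ u hu
      rwa [Nat.cast_mul, ← mul_assoc] at this
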